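/- **Conventions.** A map is a cellular embedding of a finite simple graph in a connected closed surface. It is equivelar of type $[3^7]$ if all faces are triangles and each vertex lies on exactly 7 of them. A 12-vertex map of type $[3^7]$ on the double torus (the closed orientable surface with $\chi=-2$) is denoted by $N$. The *homological quantum code* of a map $K$ with such triangular faces has one qubit for each edge. It is the stabilizer code whose stabilizer group $\mathcal S$ is generated by the operators $A_v=\bigotimes_{e\ni v}X_e$ ($v$ a vertex) and $B_f=\bigotimes_{e\subset f}Z_e$ ($f$ a face); that is, its check matrices are the vertex-edge and face-edge incidence matrices $H_X,H_Z$ over $\mathbb Z_2$, which satisfy $H_XH_Z^T=0$. It is an $[[n,k,\delta]]$ code if it has $n$ qubits, $\mathcal S$ is a subgroup of the Pauli group with $-I\notin\mathcal S$, the space of states fixed by $\mathcal S$ has dimension $2^k$, and $\delta$ is the minimum weight of a Pauli operator that commutes with every element of $\mathcal S$ and does not lie, up to a scalar in $\{\pm1,\pm i\}$, in $\mathcal S$. Let $C$ be a non-separating cycle in the graph of $N$. Cutting $N$ along $C$ gives a map $N_*$ with two boundary cycles $A$ and $B$, both copies of $C$. Take $d\ge 1$ copies of $N_*$ with boundary cycles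 $A_j,B_j$, and identify $B_j$ with $A_{j+1}$ for $1\le j\le d-1$ and $B_d$ with $A_1$ (corresponding points over the same point of $C$). The result $N^d=N^d_C$ is the *$d$-th cover of $N$ along $C$*. **Statement.** The map $N_1$ with vertices $1,\dots,12$ and faces 123, 124, 135, 146, 157, 168, 178, 236, 247, 269, 2 7 10, 2 9 10, 359, 3 6 11, 3 9 12, 3 11 12, 469, 478, 4 8 12, 4 9 12, 5 7 11, 5 9 10, 5 10 12, 5 11 12, 6 8 11, 7 10 11, 8 10 11, 8 10 12 is a map of type $[3^7]$ on the double torus. Moreover, let $N$ be any 12-vertex map of type $[3^7]$ on the double torus. 1. The homological quantum code of $N$ is a $[[42,4,3]]$ code. 2. $N$ has a non-separating cycle of length 3. 3. Let $C$ be any non-separating cycle of $N$. Cutting $N$ along $C$ does give two boundary cycles $A,B$ as above and, whichever of the two is called $A$, for every $d\ge1$ the cover $N^d_C$ is an equivelar map of type $[3^7]$ on a connected closed orientable surface, with $12d$ vertices, $42d$ edges and Euler characteristic $-2d$. Its homological quantum code is a $[[42d,\,2(1+d),\,\delta]]$ code for some $\delta\ge3$, and $\delta=3$ if and only if $N^d_C$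 has a non-separating cycle of length 3. 4. If $C$ has length 3, then for every $d\ge1$ the homological quantum code of $N^d_C$ is a $[[42d,\,2(1+d),\,3]]$ code. -/

import Mathlib

namespace SurfaceCode

/-! ### Triangulated surfaces

A map all of whose faces are triangles and all of whose vertices have degree at least 4 is
determined by the vertex sets of its faces: the underlying graph is simple, so a triangular face is
bounded by a 3-cycle, and two distinct faces with the same vertex set would force a vertex of
degree 2. So a map of type [3^7] is given by a finite set `F` of 3-element subsets (the faces) of
its vertex set `V`. -/

section Maps

variable {V : Type*} [DecidableEq V]

/-- The edges: the 2-element subsets of the faces. -/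
def edges (F : Finset (Finset V)) : Finset (Finset V) :=
  F.biUnion fun f => f.powersetCard 2

/-- The dual graph: two faces are adjacent when they share an edge. -/
def dualGraph (F : Finset (Finset V)) : SimpleGraph {f // f ∈ F} where
  Adj f g := f ≠ g ∧ (f.1 ∩ g.1).card = 2
  symm := ⟨fun f g h => ⟨h.1.symm, by rw [Finset.inter_comm]; exact h.2⟩⟩
  loopless := ⟨fun _ h => h.1 rfl⟩

/-- `F` is the set of faces of a triangulation of a connected closed surface with vertex set `V`.
By `two_faces` each face at `v` has exactly two neighbours in the dual graph among the faces at `v`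
(one across each of its two edges at `v`), so `face_cycle` says that the faces at `v` form a single
cycle. -/
structure IsTriangulatedSurface (F : Finset (Finset V)) : Prop where
  card_three : ∀ f ∈ F, f.card = 3
  two_faces : ∀ e ∈ edges F, (F.filter fun f => e ⊆ f).card = 2
  face_cycle : ∀ v : V, ((dualGraph F).induce {f | v ∈ f.1}).Connected
  connected : (dualGraph F).Connected

/-- Every vertex lies on exactly `q` triangles: the map is equivelar of type [3^q]. -/
def IsOfType3 (F : Finset (Finset V)) (q : ℕ) : Prop :=
  ∀ v : V, (F.filter fun f => v ∈ f).card = q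

/-- A coherent orientation: `o a b c` says that the face `{a, b, c}` carries the cyclic order
`a → b → c → a`. Each face carries exactly one of its two cyclic orders, and the two faces at an
edge induce opposite directions on it (no directed edge `a → b` is used by two faces). -/
structure IsOrientation (F : Finset (Finset V)) (o : V → V → V → Prop) : Prop where
  face : ∀ a b c, o a b c → ({a, b, c} : Finset V) ∈ F
  cyclic : ∀ a b c, o a b c → o b c a
  exactly_one : ∀ a b c, ({a, b, c} : Finset V) ∈ F → Xor (o a b c) (o a c b)
  coherent : ∀ a b c c', o a b c → o a b c' → c = c'

def IsOrientable (F : Finset (Finset V)) : Prop :=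
  ∃ o : V → V → V → Prop, IsOrientation F o

def eulerChar [Fintype V] (F : Finset (Finset V)) : ℤ :=
  (Fintype.card V : ℤ) - ((edges F).card : ℤ) + (F.card : ℤ)

/-- An equivelar map of type [3^7] on the double torus, the connected closed orientable surface of
Euler characteristic `-2`. -/
structure IsDoubleTorusMap37 [Fintype V] (F : Finset (Finset V)) : Prop where
  surface : IsTriangulatedSurface F
  orientable : IsOrientable F
  euler : eulerChar F = -2
  type37 : IsOfType3 F 7

/-! ### Cutting along a cycle and the `d`-th cover -/

/-- `C(c 0, c 1, …, c (k-1))` is a cycle of length `k` in the graph of the map. -/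
structure IsCycle (F : Finset (Finset V)) {k : ℕ} (c : ZMod k → V) : Prop where
  three_le : 3 ≤ k
  injective : Function.Injective c
  edge : ∀ i, ({c i, c (i + 1)} : Finset V) ∈ edges F

def cycleEdges {k : ℕ} (c : ZMod k → V) : Set (Finset V) :=
  {e | ∃ i, e = {c i, c (i + 1)}}

/-- Adjacency of the faces of the map cut along `c`: faces are glued along the edges not on `c`. -/
def cutDualGraph (F : Finset (Finset V)) {k : ℕ} (c : ZMod k → V) :
    SimpleGraph {f // f ∈ F} where
  Adj f g := (dualGraph F).Adj f g ∧ f.1 ∩ g.1 ∉ cycleEdges c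
  symm := ⟨fun f g h => ⟨h.1.symm, by rw [Finset.inter_comm]; exact h.2⟩⟩
  loopless := ⟨fun _ h => h.1.1 rfl⟩

/-- Cutting the surface along `c` leaves it connected. -/
def IsNonseparating (F : Finset (Finset V)) {k : ℕ} (c : ZMod k → V) : Prop :=
  (cutDualGraph F c).Connected

/-- A splitting of the boundary of the map cut along `c` into the two copies
`A(p_1, …, p_k)` and `B(q_1, …, q_k)` of `c`. After the cut a vertex `v` on `c` becomes two
vertices, `p` on `A` and `q` on `B`, and each corner `(v, f)` (a face `f` with a vertex `v` of it)
belongs to one of the two; `B` is the set of the corners which belong to `q`.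
Faces glued along an edge not on `c` have the same copy of each endpoint of that edge, the two faces
at an edge of `c` have different copies of its endpoints, and the edges of each boundary cycle join
consecutive vertices of the same boundary cycle. -/
structure IsCutSide (F : Finset (Finset V)) {k : ℕ} (c : ZMod k → V)
    (B : Finset (V × Finset V)) : Prop where
  corner : ∀ v f, (v, f) ∈ B → f ∈ F ∧ v ∈ f ∧ v ∈ Set.range c
  glued : ∀ f ∈ F, ∀ g ∈ F, ∀ e ∈ edges F, e ⊆ f → e ⊆ g → e ∉ cycleEdges c →
    ∀ v ∈ e, ((v, f) ∈ B ↔ (v, g) ∈ B)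
  cut : ∀ f ∈ F, ∀ g ∈ F, f ≠ g → ∀ e ∈ cycleEdges c, e ⊆ f → e ⊆ g →
    ∀ v ∈ e, ((v, f) ∈ B ↔ (v, g) ∉ B)
  boundary : ∀ f ∈ F, ∀ e ∈ cycleEdges c, e ⊆ f →
    ∀ u ∈ e, ∀ v ∈ e, ((u, f) ∈ B ↔ (v, f) ∈ B)

/-- The faces of the `d`-th cover: take `d` copies of the map cut along the cycle, indexed
cyclically by `ZMod d`, and identify the boundary `B` of copy `i` with the boundary `A` of copy
`i + 1`. The vertex `(v, i)` of the result is the copy of `v` in the `i`-th cut map if `v` is not on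
the cycle; if `v` is on the cycle it is the vertex `p` over `v` in the copy `i`, identified with the
vertex `q` over `v` in the copy `i - 1`. Hence the copy of the face `f` in the `i`-th cut map has at
its corner `v` the vertex `(v, i + 1)` if that corner lies on `B`, and `(v, i)` otherwise. -/
def coverFaces (F : Finset (Finset V)) (B : Finset (V × Finset V)) (d : ℕ) [NeZero d] :
    Finset (Finset (V × ZMod d)) :=
  (F ×ˢ (Finset.univ : Finset (ZMod d))).image fun p =>
    p.1.image fun v => (v, p.2 + if (v, p.1) ∈ B then 1 else 0)

end Maps

/-! ### Stabilizer codes -/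

inductive Pauli : Type
  | I : Pauli
  | X : Pauli
  | Y : Pauli
  | Z : Pauli

def Pauli.toMatrix : Pauli → Matrix (Fin 2) (Fin 2) ℂ
  | .I => 1
  | .X => !![0, 1; 1, 0]
  | .Y => !![0, -Complex.I; Complex.I, 0]
  | .Z => !![1, 0; 0, -1]

section Codes

variable {E : Type*} [Fintype E] [DecidableEq E]

/-- The tensor product `⨂ e, P e`, acting on the state space of the qubits indexed by `E`, whose
basis vectors `|a⟩` are indexed by `a : E → Fin 2`. -/
def pauliOp (P : E → Pauli) : Matrix (E → Fin 2) (E → Fin 2) ℂ :=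
  Matrix.of fun a b => ∏ e, (P e).toMatrix (a e) (b e)

/-- The weight: the number of factors different from the identity. -/
noncomputable def weight (P : E → Pauli) : ℕ := Nat.card {e // P e ≠ Pauli.I}

/-- The scalars allowed in the Pauli group. -/
def phases : Set ℂ := {1, -1, Complex.I, -Complex.I}

/-- The states fixed by all elements of `S`. -/
def codeSpace (S : Submonoid (Matrix (E → Fin 2) (E → Fin 2) ℂ)) :
    Submodule ℂ ((E → Fin 2) → ℂ) where
  carrier := {ψ | ∀ M ∈ S, M.mulVec ψ = ψ}
  add_mem' := fun {x y} hx hy M hM => by rw [Matrix.mulVec_add, hx M hM, hy M hM]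
  zero_mem' := fun M _ => Matrix.mulVec_zero M
  smul_mem' := fun a x hx M hM => by rw [Matrix.mulVec_smul, hx M hM]

/-- `S` is a subgroup of the Pauli group with `-I ∉ S` whose stabilizer code is an `[[n, k, δ]]`
quantum code: there are `n` qubits, the code space has dimension `2 ^ k`, and `δ` is the least weight
of a Pauli operator that commutes with `S` and is not, up to a scalar, in `S`. -/
structure IsStabilizerCode (S : Submonoid (Matrix (E → Fin 2) (E → Fin 2) ℂ))
    (n k δ : ℕ) : Prop where
  pauli : ∀ M ∈ S, ∃ a ∈ phases, ∃ P : E → Pauli, M = a • pauliOp P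
  inverse : ∀ M ∈ S, ∃ N ∈ S, M * N = 1
  neg_one_notMem : -1 ∉ S
  length : Fintype.card E = n
  dimension : Module.finrank ℂ (codeSpace S) = 2 ^ k
  distance : IsLeast {w | ∃ P : E → Pauli, (∀ M ∈ S, pauliOp P * M = M * pauliOp P) ∧
    (∀ a ∈ phases, a • pauliOp P ∉ S) ∧ weight P = w} δ

/-- The group generated by the operators with binary check matrix `[[HX, 0], [0, HZ]]`: a row of
`HX` gives a tensor product of `X`s, a row of `HZ` a tensor product of `Z`s. -/
def checkGroup {R R' : Type*} (HX : Matrix R E (ZMod 2)) (HZ : Matrix R' E (ZMod 2)) :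
    Submonoid (Matrix (E → Fin 2) (E → Fin 2) ℂ) :=
  Submonoid.closure
    (Set.range (fun r => pauliOp fun e => if HX r e = 0 then Pauli.I else Pauli.X) ∪
      Set.range (fun r => pauliOp fun e => if HZ r e = 0 then Pauli.I else Pauli.Z))

end Codes

section HomologicalCodes

variable {V : Type*} [DecidableEq V]

/-- The vertex-edge incidence matrix, which is the matrix of `∂₁` over `ZMod 2`. -/
def vertexEdgeMatrix (F : Finset (Finset V)) : Matrix V {e // e ∈ edges F} (ZMod 2) :=
  Matrix.of fun v e => if v ∈ e.1 then 1 else 0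

/-- The face-edge incidence matrix, which is the transpose of the matrix of `∂₂` over `ZMod 2`. -/
def faceEdgeMatrix (F : Finset (Finset V)) :
    Matrix {f // f ∈ F} {e // e ∈ edges F} (ZMod 2) :=
  Matrix.of fun f e => if e.1 ⊆ f.1 then 1 else 0

/-- The homological quantum code of the map `F`, with one qubit for each edge, is defined and has
parameters `[[n, k, δ]]`. -/
def GivesCode (F : Finset (Finset V)) (n k δ : ℕ) : Prop :=
  vertexEdgeMatrix F * (faceEdgeMatrix F).transpose = 0 ∧
    IsStabilizerCode (checkGroup (vertexEdgeMatrix F) (faceEdgeMatrix F)) n k δ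

end HomologicalCodes

/-- The 12-vertex map `N_1` on the vertices `0, …, 11`. -/
def mapN1 : Finset (Finset (Fin 12)) :=
  {{0, 1, 2}, {0, 1, 3}, {0, 2, 4}, {0, 3, 5}, {0, 4, 6}, {0, 5, 7}, {0, 6, 7},
   {1, 2, 5}, {1, 3, 6}, {1, 5, 8}, {1, 6, 9}, {1, 8, 9}, {2, 4, 8}, {2, 5, 10},
   {2, 8, 11}, {2, 10, 11}, {3, 5, 8}, {3, 6, 7}, {3, 7, 11}, {3, 8, 11}, {4, 6, 10},
   {4, 8, 9}, {4, 9, 11}, {4, 10, 11}, {5, 7, 10}, {6, 9, 10}, {7, 9, 10}, {7, 9, 11}}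

end SurfaceCode

set_option linter.unusedSectionVars false

/-! The code is of CSS type. Up to a phase every Pauli operator is `X ^ a Z ^ b` with `a`, `b` over
`ZMod 2`, and two of these commute exactly when a symplectic form of the exponents vanishes. As `HX
* HZ.transpose = 0`, the stabilizer group consists of the `xz a b` with `a` in the row space of `HX`
and `b` in that of `HZ`. The code space is the space of functions on `ker HZ / row HX`, and a
nontrivial logical operator is a cocycle `a` with a cycle `b`, not both trivial in (co)homology
(`isStabilizerCode_iff`, `finrank_codeSpace`).

On a connected closed surface the two incidence matrices have ranks `|V| - 1` and `|F| - 1`, so `k =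
2 - χ`. A nonzero cycle in a simple graph has at least three edges. A nonzero cocycle has at least
four when all degrees are at least 4, because three edges would be the edges at a vertex of degree
3. Hence `δ ≥ 3`, with equality exactly when some 3-cycle does not bound, that is, does not separate
(`givesCode_of_surface`).

On 12 vertices of degree 7 such a triangle exists by counting. If all triangles were faces, adjacent
vertices would have at most two common neighbours, which is too few. A triangle that is not a face
cannot separate, because the closed neighbourhoods of a vertex on either side would together need 8
+ 8 - 3 = 13 vertices (`exists_nonseparating_triangle`).

For the cover, the orientation sorts the corners along the cycle into left and right, which gives a
cut side. Each face or edge of the base has one lift through each point of the cover above a chosen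
vertex of it, so the cover is locally a copy of the base. Cut along one lift of the cycle, its `d`
layers still form a connected chain (`isNonseparating_lift`). This shows that the cover is connected
and that the lift of a nonseparating triangle is again one. -/

namespace SurfaceCode

/-! ### Calderbank–Shor–Steane codes -/

section Codes

variable {E : Type*} [Fintype E] [DecidableEq E]

/-- The sign character of `ZMod 2`. -/
def sgn (x : ZMod 2) : ℂ := if x = 0 then 1 else -1

lemma zmod_two_cases : ∀ x : ZMod 2, x = 0 ∨ x = 1 := by decide

@[simp] lemma sgn_zero : sgn 0 = 1 := by simp [sgn]

@[simp] lemma sgn_one : sgn 1 = -1 := by simp [sgn]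

lemma sgn_add (x y : ZMod 2) : sgn (x + y) = sgn x * sgn y := by
  have h : (1 : ZMod 2) + 1 = 0 := by decide
  rcases zmod_two_cases x with rfl | rfl <;> rcases zmod_two_cases y with rfl | rfl <;> simp [h]

lemma sgn_ne_zero (x : ZMod 2) : sgn x ≠ 0 := by
  rcases zmod_two_cases x with rfl | rfl <;> simp

lemma sgn_sum (x : E → ZMod 2) (s : Finset E) : sgn (∑ e ∈ s, x e) = ∏ e ∈ s, sgn (x e) := by
  induction s using Finset.induction_on with
  | empty => simp
  | insert a s ha ih => rw [Finset.sum_insert ha, Finset.prod_insert ha, sgn_add, ih]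

/-- A bit as an element of `ZMod 2`. -/
def bit : Fin 2 ≃ ZMod 2 := Equiv.refl _

@[simp] lemma bit_zero : bit 0 = 0 := rfl

@[simp] lemma bit_one : bit 1 = 1 := rfl

/-- A basis state as a vector over `ZMod 2`. -/
def bits : (E → Fin 2) ≃ (E → ZMod 2) :=
  Equiv.arrowCongr (Equiv.refl E) bit

lemma bits_apply (i : E → Fin 2) (e : E) : bits i e = bit (i e) := rfl

/-- The Pauli operator `X ^ a Z ^ b`. Its entry at `(i, j)` is `(-1) ^ (b ⬝ j)` if `i = j + a` and
`0` otherwise. -/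
def xz (a b : E → ZMod 2) : Matrix (E → Fin 2) (E → Fin 2) ℂ :=
  Matrix.of fun i j => if bits i = bits j + a then sgn (b ⬝ᵥ bits j) else 0

lemma add_self_zmod (a : E → ZMod 2) : a + a = 0 := by
  ext e; exact CharTwo.add_self_eq_zero _

lemma xz_mulVec (a b : E → ZMod 2) (ψ : (E → Fin 2) → ℂ) (i : E → Fin 2) :
    (xz a b).mulVec ψ i = sgn (b ⬝ᵥ (bits i + a)) * ψ (bits.symm (bits i + a)) := by
  have h : ∀ j, bits i = bits j + a ↔ j = bits.symm (bits i + a) := fun j => by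
    rw [Equiv.eq_symm_apply]
    constructor
    · intro h; rw [h, add_assoc, add_self_zmod, add_zero]
    · intro h; rw [h, add_assoc, add_self_zmod, add_zero]
  simp [Matrix.mulVec, dotProduct, xz, h]

/-- Moving `Z ^ b` past `X ^ a'` costs one sign per common qubit. -/
lemma xz_mul (a b a' b' : E → ZMod 2) :
    xz a b * xz a' b' = sgn (b ⬝ᵥ a') • xz (a + a') (b + b') := by
  apply Matrix.toLin'.injective
  refine LinearMap.ext fun ψ => ?_
  funext i
  simp only [Matrix.toLin'_mul, LinearMap.comp_apply, map_smul, LinearMap.smul_apply,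
    Matrix.toLin'_apply, Pi.smul_apply, smul_eq_mul, xz_mulVec, Equiv.apply_symm_apply]
  rw [← mul_assoc, ← mul_assoc, ← sgn_add, ← sgn_add, add_assoc (bits i), add_dotProduct]
  congr 2
  rw [← add_assoc (bits i) a a', dotProduct_add b (bits i + a) a']
  linear_combination -CharTwo.add_self_eq_zero (b ⬝ᵥ a')

lemma xz_zero : xz (0 : E → ZMod 2) 0 = 1 := by
  ext i j
  simp [xz, Matrix.one_apply]

/-- The positions of the nonzero entries determine `a`, the column of the zero state gives the
scalar, and the columns of the unit vectors give `b`. -/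
lemma smul_xz_inj {s s' : ℂ} (hs : s ≠ 0) {a b a' b' : E → ZMod 2}
    (h : s • xz a b = s' • xz a' b') : s = s' ∧ a = a' ∧ b = b' := by
  have key : ∀ j : E → ZMod 2, (if a = a' then s' * sgn (b' ⬝ᵥ j) else 0) = s * sgn (b ⬝ᵥ j) := by
    intro j
    have := congrFun (congrFun h (bits.symm (j + a))) (bits.symm j)
    simpa [xz] using this.symm
  have ha : a = a' := by
    by_contra hne
    have := key 0
    rw [if_neg hne] at this
    exact mul_ne_zero hs (sgn_ne_zero _) this.symm
  simp only [if_pos ha] at key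
  have hss : s' = s := by simpa using key 0
  refine ⟨hss.symm, ha, ?_⟩
  ext e
  have := key (Pi.single e 1)
  simp only [dotProduct_single, mul_one, hss] at this
  have h2 := mul_left_cancel₀ hs this
  rcases zmod_two_cases (b e) with h | h <;> rcases zmod_two_cases (b' e) with h' | h' <;>
    rw [h, h'] at h2 ⊢ <;> norm_num at h2

/-- Both products are the same operator up to signs, so commuting means that the signs agree. -/
lemma xz_commute_iff (a b a' b' : E → ZMod 2) :
    xz a b * xz a' b' = xz a' b' * xz a b ↔ b ⬝ᵥ a' + a ⬝ᵥ b' = 0 := by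
  rw [xz_mul, xz_mul, add_comm a' a, add_comm b' b, dotProduct_comm b' a]
  constructor
  · intro h
    have := (smul_xz_inj (sgn_ne_zero _) h).1
    rcases zmod_two_cases (b ⬝ᵥ a') with h | h <;> rcases zmod_two_cases (a ⬝ᵥ b') with h' | h' <;>
      rw [h, h'] at this ⊢ <;> first | rfl | norm_num at this
  · intro h
    rw [CharTwo.add_eq_zero] at h
    rw [h]

/-- The exponent of `X` in a Pauli matrix. -/
def Pauli.xPart : Pauli → ZMod 2
  | .I => 0
  | .X => 1
  | .Y => 1
  | .Z => 0

/-- The exponent of `Z` in a Pauli matrix. -/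
def Pauli.zPart : Pauli → ZMod 2
  | .I => 0
  | .X => 0
  | .Y => 1
  | .Z => 1

/-- The scalar relating a Pauli matrix to the corresponding product of powers of `X` and `Z`. -/
def Pauli.phase : Pauli → ℂ
  | .I => 1
  | .X => 1
  | .Y => Complex.I
  | .Z => 1

/-- The Pauli matrix with given exponents. -/
def Pauli.ofParts (s t : ZMod 2) : Pauli :=
  if s = 0 then if t = 0 then .I else .Z else if t = 0 then .X else .Y

lemma Pauli.toMatrix_apply (p : Pauli) (i j : Fin 2) :
    p.toMatrix i j = p.phase * if bit i = bit j + p.xPart then sgn (p.zPart * bit j) else 0 := by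
  have h : (1 : ZMod 2) + 1 = 0 := by decide
  fin_cases i <;> fin_cases j <;> cases p <;>
    simp [Pauli.toMatrix, Pauli.phase, Pauli.xPart, Pauli.zPart, h]

lemma prod_ite_eq_zero {s : Finset E} {p : E → Prop} [DecidablePred p] (f : E → ℂ) :
    (∏ e ∈ s, if p e then f e else 0) = if ∀ e ∈ s, p e then ∏ e ∈ s, f e else 0 := by
  split_ifs with h
  · exact Finset.prod_congr rfl fun e he => if_pos (h e he)
  · push Not at h
    obtain ⟨e, he, hp⟩ := h
    exact Finset.prod_eq_zero he (if_neg hp)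

/-- The exponents of `X` in a Pauli operator. -/
def xVec (P : E → Pauli) : E → ZMod 2 := fun e => (P e).xPart

/-- The exponents of `Z` in a Pauli operator. -/
def zVec (P : E → Pauli) : E → ZMod 2 := fun e => (P e).zPart

/-- The Pauli operator with given exponents. -/
def pauliOfParts (a b : E → ZMod 2) : E → Pauli := fun e => Pauli.ofParts (a e) (b e)

/-- The passage from Pauli strings to pairs of binary vectors. Only the factors `Y = i X Z`
contribute to the phase. -/
lemma pauliOp_eq (P : E → Pauli) :
    pauliOp P = (∏ e, (P e).phase) • xz (xVec P) (zVec P) := by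
  ext i j
  simp only [pauliOp, Matrix.of_apply, Pauli.toMatrix_apply, Finset.prod_mul_distrib,
    Matrix.smul_apply, smul_eq_mul, xz]
  rw [prod_ite_eq_zero, dotProduct, sgn_sum]
  simp only [Finset.mem_univ, true_imp_iff, funext_iff, Pi.add_apply, bits_apply, xVec, zVec]

lemma ofParts_xPart (s t : ZMod 2) : (Pauli.ofParts s t).xPart = s := by
  rcases zmod_two_cases s with rfl | rfl <;> rcases zmod_two_cases t with rfl | rfl <;> rfl

lemma ofParts_zPart (s t : ZMod 2) : (Pauli.ofParts s t).zPart = t := by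
  rcases zmod_two_cases s with rfl | rfl <;> rcases zmod_two_cases t with rfl | rfl <;> rfl

lemma xVec_ofParts (a b : E → ZMod 2) : xVec (pauliOfParts a b) = a :=
  funext fun _ => ofParts_xPart _ _

lemma zVec_ofParts (a b : E → ZMod 2) : zVec (pauliOfParts a b) = b :=
  funext fun _ => ofParts_zPart _ _

lemma Pauli.ne_one_iff (p : Pauli) : p ≠ .I ↔ p.xPart ≠ 0 ∨ p.zPart ≠ 0 := by
  have h10 : (1 : ZMod 2) ≠ 0 := by decide
  cases p <;> simp [Pauli.xPart, Pauli.zPart, h10]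

lemma weight_eq (P : E → Pauli) :
    weight P = (Finset.univ.filter fun e => xVec P e ≠ 0 ∨ zVec P e ≠ 0).card := by
  unfold weight
  rw [Nat.card_congr (Equiv.subtypeEquivRight fun e => (P e).ne_one_iff), Nat.card_eq_fintype_card,
    Fintype.card_subtype]
  rfl

lemma one_mem_phases : (1 : ℂ) ∈ phases := by simp [phases]

lemma phases_ne_zero {a : ℂ} (h : a ∈ phases) : a ≠ 0 := by
  rcases h with rfl | rfl | rfl | rfl <;> simp

lemma phases_mul {a b : ℂ} (ha : a ∈ phases) (hb : b ∈ phases) : a * b ∈ phases := by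
  rcases ha with rfl | rfl | rfl | rfl <;> rcases hb with rfl | rfl | rfl | rfl <;> simp [phases]

lemma phases_inv {a : ℂ} (ha : a ∈ phases) : a⁻¹ ∈ phases := by
  rcases ha with rfl | rfl | rfl | rfl <;> simp [phases]

lemma prod_phase_mem (P : E → Pauli) (s : Finset E) : ∏ e ∈ s, (P e).phase ∈ phases := by
  induction s using Finset.induction_on with
  | empty => exact one_mem_phases
  | insert e s he ih =>
    rw [Finset.prod_insert he]
    refine phases_mul ?_ ih
    cases P e <;> simp [Pauli.phase, phases]

end Codes
-- Stabilizer group, logical operators and code space of a CSS code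
section Codes
variable {E : Type*} [Fintype E] [DecidableEq E]

/-- The row space of a check matrix. -/
def rowSpace {R : Type*} (H : Matrix R E (ZMod 2)) : Submodule (ZMod 2) (E → ZMod 2) :=
  Submodule.span (ZMod 2) (Set.range H)

/-- The vectors orthogonal to all rows of a check matrix. -/
def checkKer {R : Type*} (H : Matrix R E (ZMod 2)) : Submodule (ZMod 2) (E → ZMod 2) :=
  LinearMap.ker H.mulVecLin

lemma mem_checkKer {R : Type*} {H : Matrix R E (ZMod 2)} {x : E → ZMod 2} :
    x ∈ checkKer H ↔ ∀ r, H r ⬝ᵥ x = 0 := by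
  simp only [checkKer, LinearMap.mem_ker, Matrix.mulVecLin_apply, funext_iff]
  rfl

lemma dotProduct_eq_zero_of_mem {R : Type*} {H : Matrix R E (ZMod 2)} {x y : E → ZMod 2}
    (hx : x ∈ checkKer H) (hy : y ∈ rowSpace H) : y ⬝ᵥ x = 0 := by
  induction hy using Submodule.span_induction with
  | mem y hy => obtain ⟨r, rfl⟩ := hy; exact mem_checkKer.1 hx r
  | zero => exact zero_dotProduct x
  | add y z _ _ hy hz => rw [add_dotProduct, hy, hz, add_zero]
  | smul c y _ hy => rw [smul_dotProduct, hy, smul_zero]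

lemma mem_checkKer_iff {R : Type*} {H : Matrix R E (ZMod 2)} {x : E → ZMod 2} :
    x ∈ checkKer H ↔ ∀ y ∈ rowSpace H, y ⬝ᵥ x = 0 :=
  ⟨fun hx _ hy => dotProduct_eq_zero_of_mem hx hy,
    fun h => mem_checkKer.2 fun r => h _ (Submodule.subset_span ⟨r, rfl⟩)⟩

variable {R R' : Type*} {HX : Matrix R E (ZMod 2)} {HZ : Matrix R' E (ZMod 2)}

lemma rowSpace_le_checkKer (h : HX * HZ.transpose = 0) : rowSpace HX ≤ checkKer HZ := by
  refine Submodule.span_le.2 ?_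
  rintro _ ⟨r, rfl⟩
  refine mem_checkKer.2 fun r' => ?_
  rw [dotProduct_comm]
  exact congrFun (congrFun h r) r'

lemma pauliOp_xType (a : E → ZMod 2) :
    (pauliOp fun e => if a e = 0 then Pauli.I else Pauli.X) = xz a 0 := by
  rw [pauliOp_eq]
  have h1 : ∏ e, (if a e = 0 then Pauli.I else Pauli.X).phase = 1 :=
    Finset.prod_eq_one fun e _ => by split_ifs <;> rfl
  rw [h1, one_smul]
  congr 1 <;> funext e <;> rcases zmod_two_cases (a e) with h | h <;>
    simp [xVec, zVec, h, Pauli.xPart, Pauli.zPart]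

lemma pauliOp_zType (a : E → ZMod 2) :
    (pauliOp fun e => if a e = 0 then Pauli.I else Pauli.Z) = xz 0 a := by
  rw [pauliOp_eq]
  have h1 : ∏ e, (if a e = 0 then Pauli.I else Pauli.Z).phase = 1 :=
    Finset.prod_eq_one fun e _ => by split_ifs <;> rfl
  rw [h1, one_smul]
  congr 1 <;> funext e <;> rcases zmod_two_cases (a e) with h | h <;>
    simp [xVec, zVec, h, Pauli.xPart, Pauli.zPart]

lemma xz_left_mem {a : E → ZMod 2} (ha : a ∈ rowSpace HX) : xz a 0 ∈ checkGroup HX HZ := by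
  induction ha using Submodule.span_induction with
  | mem y hy =>
    obtain ⟨r, rfl⟩ := hy
    exact Submonoid.subset_closure (Or.inl ⟨r, pauliOp_xType _⟩)
  | zero => rw [xz_zero]; exact one_mem _
  | add y z _ _ hy hz => simpa [xz_mul] using mul_mem hy hz
  | smul c y _ hy =>
    rcases zmod_two_cases c with rfl | rfl
    · rw [zero_smul, xz_zero]; exact one_mem _
    · rwa [one_smul]

lemma xz_right_mem {b : E → ZMod 2} (hb : b ∈ rowSpace HZ) : xz 0 b ∈ checkGroup HX HZ := by
  induction hb using Submodule.span_induction with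
  | mem y hy =>
    obtain ⟨r, rfl⟩ := hy
    exact Submonoid.subset_closure (Or.inr ⟨r, pauliOp_zType _⟩)
  | zero => rw [xz_zero]; exact one_mem _
  | add y z _ _ hy hz => simpa [xz_mul] using mul_mem hy hz
  | smul c y _ hy =>
    rcases zmod_two_cases c with rfl | rfl
    · rw [zero_smul, xz_zero]; exact one_mem _
    · rwa [one_smul]

lemma xz_mem {a b : E → ZMod 2} (ha : a ∈ rowSpace HX) (hb : b ∈ rowSpace HZ) :
    xz a b ∈ checkGroup HX HZ := by
  simpa [xz_mul] using mul_mem (xz_left_mem (HZ := HZ) ha) (xz_right_mem (HX := HX) hb)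

/-- Orthogonality of the two row spaces kills the sign in `xz_mul`, so these operators are closed
under multiplication and no phase ever appears. -/
lemma mem_checkGroup_iff (h : HX * HZ.transpose = 0) {M : Matrix (E → Fin 2) (E → Fin 2) ℂ} :
    M ∈ checkGroup HX HZ ↔ ∃ a ∈ rowSpace HX, ∃ b ∈ rowSpace HZ, M = xz a b := by
  constructor
  · intro hM
    induction hM using Submonoid.closure_induction with
    | mem M hM =>
      rcases hM with ⟨r, rfl⟩ | ⟨r, rfl⟩
      · exact ⟨HX r, Submodule.subset_span ⟨r, rfl⟩, 0, zero_mem _, pauliOp_xType _⟩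
      · exact ⟨0, zero_mem _, HZ r, Submodule.subset_span ⟨r, rfl⟩, pauliOp_zType _⟩
    | one => exact ⟨0, zero_mem _, 0, zero_mem _, xz_zero.symm⟩
    | mul M N _ _ hM hN =>
      obtain ⟨a, ha, b, hb, rfl⟩ := hM
      obtain ⟨a', ha', b', hb', rfl⟩ := hN
      refine ⟨_, add_mem ha ha', _, add_mem hb hb', ?_⟩
      rw [xz_mul, dotProduct_eq_zero_of_mem (rowSpace_le_checkKer h ha') hb, sgn_zero, one_smul]
  · rintro ⟨a, ha, b, hb, rfl⟩
    exact xz_mem ha hb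

/-- Testing against pure `Z` and pure `X` elements of the group decouples the symplectic condition
into one condition on each exponent vector. -/
lemma pauliOp_commute_iff (h : HX * HZ.transpose = 0) (P : E → Pauli) :
    (∀ M ∈ checkGroup HX HZ, pauliOp P * M = M * pauliOp P) ↔
      xVec P ∈ checkKer HZ ∧ zVec P ∈ checkKer HX := by
  have hc := phases_ne_zero (prod_phase_mem P Finset.univ)
  have key : ∀ a b, pauliOp P * xz a b = xz a b * pauliOp P ↔
      zVec P ⬝ᵥ a + xVec P ⬝ᵥ b = 0 := by
    intro a b
    rw [pauliOp_eq, Matrix.smul_mul, Matrix.mul_smul, (smul_right_injective _ hc).eq_iff,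
      xz_commute_iff]
  constructor
  · intro H
    refine ⟨mem_checkKer_iff.2 fun b hb => ?_, mem_checkKer_iff.2 fun a ha => ?_⟩
    · have := (key 0 b).1 (H _ (xz_right_mem hb))
      rwa [dotProduct_zero, zero_add, dotProduct_comm] at this
    · have := (key a 0).1 (H _ (xz_left_mem ha))
      rwa [dotProduct_zero, add_zero, dotProduct_comm] at this
  · rintro ⟨h1, h2⟩ M hM
    obtain ⟨a, ha, b, hb, rfl⟩ := (mem_checkGroup_iff h).1 hM
    rw [key, dotProduct_comm, dotProduct_eq_zero_of_mem h2 ha, dotProduct_comm,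
      dotProduct_eq_zero_of_mem h1 hb, add_zero]

lemma smul_pauliOp_notMem_iff (h : HX * HZ.transpose = 0) (P : E → Pauli) :
    (∀ a ∈ phases, a • pauliOp P ∉ checkGroup HX HZ) ↔
      ¬ (xVec P ∈ rowSpace HX ∧ zVec P ∈ rowSpace HZ) := by
  have hm := prod_phase_mem P Finset.univ
  have hc := phases_ne_zero hm
  constructor
  · rintro H ⟨h1, h2⟩
    refine H _ (phases_inv hm) ?_
    rw [pauliOp_eq, smul_smul, inv_mul_cancel₀ hc, one_smul]
    exact xz_mem h1 h2
  · intro H c hcp hmem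
    obtain ⟨a, ha, b, hb, hab⟩ := (mem_checkGroup_iff h).1 hmem
    rw [pauliOp_eq, smul_smul, ← one_smul ℂ (xz a b)] at hab
    obtain ⟨-, rfl, rfl⟩ := smul_xz_inj (mul_ne_zero (phases_ne_zero hcp) hc) hab
    exact H ⟨ha, hb⟩

/-- The number of qubits on which `X ^ a Z ^ b` acts nontrivially. -/
def pairWeight (a b : E → ZMod 2) : ℕ := (Finset.univ.filter fun e => a e ≠ 0 ∨ b e ≠ 0).card

/-- The pair `(a, b)` represents a nontrivial logical operator. -/
def IsLogical (HX : Matrix R E (ZMod 2)) (HZ : Matrix R' E (ZMod 2)) (a b : E → ZMod 2) : Prop :=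
  a ∈ checkKer HZ ∧ b ∈ checkKer HX ∧ ¬ (a ∈ rowSpace HX ∧ b ∈ rowSpace HZ)

/-- The group-theoretic requirements hold automatically, and the distance becomes a minimum over
pairs of binary vectors. -/
theorem isStabilizerCode_iff (h : HX * HZ.transpose = 0) (n k δ : ℕ) :
    IsStabilizerCode (checkGroup HX HZ) n k δ ↔
      Fintype.card E = n ∧ Module.finrank ℂ (codeSpace (checkGroup HX HZ)) = 2 ^ k ∧
        IsLeast {w | ∃ a b, IsLogical HX HZ a b ∧ pairWeight a b = w} δ := by
  have hset : {w | ∃ P : E → Pauli,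
      (∀ M ∈ checkGroup HX HZ, pauliOp P * M = M * pauliOp P) ∧
      (∀ a ∈ phases, a • pauliOp P ∉ checkGroup HX HZ) ∧ weight P = w} =
      {w | ∃ a b, IsLogical HX HZ a b ∧ pairWeight a b = w} := by
    ext w
    simp only [Set.mem_ofPred_eq, pauliOp_commute_iff h, smul_pauliOp_notMem_iff h, weight_eq]
    constructor
    · rintro ⟨P, h1, h2, h3⟩
      exact ⟨_, _, ⟨h1.1, h1.2, h2⟩, h3⟩
    · rintro ⟨a, b, ⟨h1, h2, h3⟩, h4⟩
      refine ⟨pauliOfParts a b, ?_⟩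
      rw [xVec_ofParts, zVec_ofParts]
      exact ⟨⟨h1, h2⟩, h3, h4⟩
  constructor
  · intro H
    exact ⟨H.length, H.dimension, hset ▸ H.distance⟩
  · rintro ⟨h1, h2, h3⟩
    refine ⟨?_, ?_, ?_, h1, h2, hset ▸ h3⟩
    · intro M hM
      obtain ⟨a, -, b, -, rfl⟩ := (mem_checkGroup_iff h).1 hM
      -- Qubits where both exponents are 1 carry a `Y`, and the resulting phase has to be divided
      -- out.
      have hm := prod_phase_mem (pauliOfParts a b) Finset.univ
      refine ⟨_, phases_inv hm, pauliOfParts a b, ?_⟩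
      rw [pauliOp_eq, smul_smul, inv_mul_cancel₀ (phases_ne_zero hm), one_smul, xVec_ofParts,
        zVec_ofParts]
    · intro M hM
      obtain ⟨a, ha, b, hb, rfl⟩ := (mem_checkGroup_iff h).1 hM
      refine ⟨_, hM, ?_⟩
      rw [xz_mul, dotProduct_eq_zero_of_mem (rowSpace_le_checkKer h ha) hb, sgn_zero, one_smul,
        add_self_zmod, add_self_zmod, xz_zero]
    · intro hM
      obtain ⟨a, -, b, -, hab⟩ := (mem_checkGroup_iff h).1 hM
      -- If `-1` were in the group, comparing scalars in `-xz 0 0 = xz a b` would give `-1 = 1`.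
      rw [← xz_zero, ← one_smul ℂ (xz a b), ← neg_one_smul ℂ (xz 0 0)] at hab
      have := (smul_xz_inj (by norm_num) hab).1
      norm_num at this

/-- A `Z`-type stabilizer multiplies amplitudes by signs and so forces them to vanish off `checkKer
HZ`. An `X`-type stabilizer translates the basis states and so makes amplitudes constant on cosets
of `rowSpace HX`. -/
lemma mem_codeSpace_iff (h : HX * HZ.transpose = 0) {ψ : (E → Fin 2) → ℂ} :
    ψ ∈ codeSpace (checkGroup HX HZ) ↔
      (∀ j, bits j ∉ checkKer HZ → ψ j = 0) ∧
      ∀ a ∈ rowSpace HX, ∀ j, ψ (bits.symm (bits j + a)) = ψ j := by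
  constructor
  · intro H
    constructor
    · intro j hj
      rw [mem_checkKer_iff] at hj
      push Not at hj
      obtain ⟨b, hb, hbj⟩ := hj
      have := congrFun (H _ (xz_right_mem hb)) j
      rw [xz_mulVec, add_zero, Equiv.symm_apply_apply] at this
      have h1 : b ⬝ᵥ bits j = 1 := (zmod_two_cases _).resolve_left hbj
      rw [h1, sgn_one] at this
      linear_combination (-1/2) * this
    · intro a ha j
      have := congrFun (H _ (xz_left_mem ha)) j
      rwa [xz_mulVec, zero_dotProduct, sgn_zero, one_mul] at this
  · rintro ⟨h1, h2⟩ M hM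
    obtain ⟨a, ha, b, hb, rfl⟩ := (mem_checkGroup_iff h).1 hM
    funext j
    rw [xz_mulVec, h2 a ha, dotProduct_add,
      dotProduct_eq_zero_of_mem (rowSpace_le_checkKer h ha) hb, add_zero]
    by_cases hj : bits j ∈ checkKer HZ
    · rw [dotProduct_eq_zero_of_mem hj hb, sgn_zero, one_mul]
    · rw [h1 j hj, mul_zero]

open Classical in
/-- A function on the quotient of `checkKer HZ` by `rowSpace HX` as a state. -/
noncomputable def quotientState (HX : Matrix R E (ZMod 2)) (HZ : Matrix R' E (ZMod 2)) :
    ((checkKer HZ ⧸ (rowSpace HX).submoduleOf (checkKer HZ)) → ℂ) →ₗ[ℂ] ((E → Fin 2) → ℂ) where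
  toFun φ j := if hj : bits j ∈ checkKer HZ then φ (Submodule.Quotient.mk ⟨bits j, hj⟩) else 0
  map_add' φ φ' := by
    funext j
    by_cases hj : bits j ∈ checkKer HZ <;> simp [hj]
  map_smul' c φ := by
    funext j
    by_cases hj : bits j ∈ checkKer HZ <;> simp [hj]

lemma quotientState_apply (φ) {j : E → Fin 2} (hj : bits j ∈ checkKer HZ) :
    quotientState HX HZ φ j = φ (Submodule.Quotient.mk ⟨bits j, hj⟩) := dif_pos hj

lemma quotientState_apply_of_notMem (φ) {j : E → Fin 2} (hj : bits j ∉ checkKer HZ) :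
    quotientState HX HZ φ j = 0 := dif_neg hj

lemma quotientState_injective : Function.Injective (quotientState HX HZ) := by
  intro φ φ' hφ
  funext q
  obtain ⟨x, rfl⟩ := Submodule.Quotient.mk_surjective _ q
  have := congrFun hφ (bits.symm x.1)
  have hx : bits (bits.symm x.1) ∈ checkKer HZ := by rw [Equiv.apply_symm_apply]; exact x.2
  rw [quotientState_apply _ hx, quotientState_apply _ hx] at this
  simpa using this

lemma range_quotientState (h : HX * HZ.transpose = 0) :
    LinearMap.range (quotientState HX HZ) = codeSpace (checkGroup HX HZ) := by
  have hsum : ∀ a ∈ rowSpace HX, ∀ j, bits j + a ∈ checkKer HZ ↔ bits j ∈ checkKer HZ :=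
    fun a ha j => Submodule.add_mem_iff_left _ (rowSpace_le_checkKer h ha)
  ext ψ
  rw [mem_codeSpace_iff h, LinearMap.mem_range]
  constructor
  · rintro ⟨φ, rfl⟩
    refine ⟨fun j hj => quotientState_apply_of_notMem _ hj, fun a ha j => ?_⟩
    by_cases hj : bits j ∈ checkKer HZ
    · have hj' : bits (bits.symm (bits j + a)) ∈ checkKer HZ := by
        rw [Equiv.apply_symm_apply]; exact (hsum a ha j).2 hj
      rw [quotientState_apply _ hj, quotientState_apply _ hj']
      congr 1
      rw [Submodule.Quotient.eq, Submodule.submoduleOf, Submodule.mem_comap]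
      simpa using ha
    · rw [quotientState_apply_of_notMem _ hj, quotientState_apply_of_notMem]
      rw [Equiv.apply_symm_apply]
      exact fun h' => hj ((hsum a ha j).1 h')
  · rintro ⟨h1, h2⟩
    -- The value on a class is read off at an arbitrary representative; the invariance `h2` makes
    -- the choice irrelevant.
    refine ⟨fun q => ψ (bits.symm (Quotient.out q).1), ?_⟩
    funext j
    by_cases hj : bits j ∈ checkKer HZ
    · rw [quotientState_apply _ hj]
      set q : checkKer HZ ⧸ (rowSpace HX).submoduleOf (checkKer HZ) :=
        Submodule.Quotient.mk ⟨bits j, hj⟩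
      have hq : (Submodule.Quotient.mk (Quotient.out q) : checkKer HZ ⧸ _) = q :=
        Quotient.out_eq q
      have := (Submodule.Quotient.eq _).1 hq
      replace this : (_ : E → ZMod 2) ∈ rowSpace HX := this
      have h3 := h2 _ this j
      rw [← h3]
      congr 2
      simp
    · rw [quotientState_apply_of_notMem _ hj, h1 j hj]

lemma finrank_checkKer [Fintype R] (H : Matrix R E (ZMod 2)) :
    Module.finrank (ZMod 2) (checkKer H) + H.rank = Fintype.card E := by
  have := LinearMap.finrank_range_add_finrank_ker H.mulVecLin
  rw [Module.finrank_fintype_fun_eq_card] at this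
  rw [checkKer, Matrix.rank, add_comm]
  exact this

lemma finrank_rowSpace [Fintype R] (H : Matrix R E (ZMod 2)) :
    Module.finrank (ZMod 2) (rowSpace H) = H.rank :=
  (Matrix.rank_eq_finrank_span_row H).symm

/-- The code space has one dimension for each element of `checkKer HZ / rowSpace HX`, a space over
`ZMod 2` of dimension `(n - rank HZ) - rank HX = k`. -/
theorem finrank_codeSpace [Fintype R] [Fintype R'] (h : HX * HZ.transpose = 0) {k : ℕ}
    (hk : k + HX.rank + HZ.rank = Fintype.card E) :
    Module.finrank ℂ (codeSpace (checkGroup HX HZ)) = 2 ^ k := by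
  have := Module.finite_of_finite (ZMod 2)
    (M := checkKer HZ ⧸ (rowSpace HX).submoduleOf (checkKer HZ))
  have := Fintype.ofFinite (checkKer HZ ⧸ (rowSpace HX).submoduleOf (checkKer HZ))
  rw [← range_quotientState h, LinearMap.finrank_range_of_inj quotientState_injective,
    Module.finrank_fintype_fun_eq_card, Module.card_eq_pow_finrank (K := ZMod 2), ZMod.card]
  congr 1
  have h1 := Submodule.finrank_quotient_add_finrank ((rowSpace HX).submoduleOf (checkKer HZ))
  have h2 := (Submodule.submoduleOfEquivOfLe (rowSpace_le_checkKer h)).finrank_eq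
  have h3 := finrank_checkKer HZ
  have h4 := finrank_rowSpace HX
  omega

/-- The kernel has dimension `k + rank HZ`, more than the row space. This makes the set of weights
defining the distance nonempty. -/
lemma exists_notMem_rowSpace [Fintype R] [Fintype R'] {k : ℕ}
    (hk : k + HX.rank + HZ.rank = Fintype.card E) (hpos : 0 < k) :
    ∃ b ∈ checkKer HX, b ∉ rowSpace HZ := by
  by_contra! H
  have h1 := Submodule.finrank_mono (show checkKer HX ≤ rowSpace HZ from H)
  have h3 := finrank_checkKer HX
  have h4 := finrank_rowSpace HZ
  omega

end Codes
/-! ### Triangulated surfaces -/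

section Connectivity

variable {α : Type*} {G : SimpleGraph α}

lemma connected_induction (hG : G.Connected) {P : α → Prop}
    (h : ∀ a b, G.Adj a b → P a → P b) {a : α} (ha : P a) (b : α) : P b := by
  obtain ⟨w⟩ := hG.preconnected a b
  induction w with
  | nil => exact ha
  | cons hadj _ ih => exact ih (h _ _ hadj ha)

/-- Applied to the property of being reachable from `a`. Together with `connected_induction` it
carries connectivity from one graph to another without handling walks. -/
lemma connected_of_induction (a : α)
    (H : ∀ P : α → Prop, (∀ a b, G.Adj a b → P a → P b) → P a → ∀ b, P b) : G.Connected := by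
  have h : ∀ b, G.Reachable a b :=
    H _ (fun b c hbc hb => hb.trans hbc.reachable) (SimpleGraph.Reachable.refl a)
  have : Nonempty α := ⟨a⟩
  exact ⟨fun b c => (h b).symm.trans (h c)⟩

end Connectivity

section Surface

variable {V : Type*} [DecidableEq V] {F : Finset (Finset V)}

lemma mem_edges_iff {e : Finset V} : e ∈ edges F ↔ ∃ f ∈ F, e ⊆ f ∧ e.card = 2 := by
  simp [edges, Finset.mem_powersetCard]

lemma card_of_mem_edges {e : Finset V} (he : e ∈ edges F) : e.card = 2 := by
  obtain ⟨f, -, -, h⟩ := mem_edges_iff.1 he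
  exact h

lemma ne_of_pair_mem_edges {u v : V} (h : ({u, v} : Finset V) ∈ edges F) : u ≠ v := by
  rintro rfl
  simpa using card_of_mem_edges h

lemma eq_pair_of_card_two {e : Finset V} {u v : V} (h : e.card = 2) (hu : u ∈ e) (hv : v ∈ e)
    (huv : u ≠ v) : e = {u, v} := by
  symm
  apply Finset.eq_of_subset_of_card_le
  · intro x; simp only [Finset.mem_insert, Finset.mem_singleton]; rintro (rfl | rfl) <;> assumption
  · rw [h, Finset.card_pair huv]

lemma exists_eq_pair_of_mem {e : Finset V} {u : V} (h : e.card = 2) (hu : u ∈ e) :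
    ∃ v, u ≠ v ∧ e = {u, v} := by
  obtain ⟨v, hv, hvu⟩ := Finset.exists_mem_ne (by omega : 1 < e.card) u
  exact ⟨v, hvu.symm, eq_pair_of_card_two h hu hv hvu.symm⟩

namespace IsTriangulatedSurface

variable (hF : IsTriangulatedSurface F)
include hF

lemma inter_eq_of_subset {f g e : Finset V} (hf : f ∈ F) (hg : g ∈ F) (hfg : f ≠ g)
    (he : e.card = 2) (hef : e ⊆ f) (heg : e ⊆ g) : f ∩ g = e := by
  symm
  apply Finset.eq_of_subset_of_card_le (Finset.subset_inter hef heg)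
  by_contra hlt
  have h1 : f ∩ g = f := Finset.eq_of_subset_of_card_le Finset.inter_subset_left
    (by rw [hF.card_three f hf]; omega)
  have h2 : f ∩ g = g := Finset.eq_of_subset_of_card_le Finset.inter_subset_right
    (by rw [hF.card_three g hg]; omega)
  exact hfg (h1.symm.trans h2)

lemma exists_two_faces {e : Finset V} (he : e ∈ edges F) :
    ∃ f g, f ∈ F ∧ g ∈ F ∧ f ≠ g ∧ e ⊆ f ∧ e ⊆ g ∧ ∀ h ∈ F, e ⊆ h → h = f ∨ h = g := by
  obtain ⟨f, g, hne, h⟩ := Finset.card_eq_two.1 (hF.two_faces e he)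
  have hf : f ∈ F.filter (e ⊆ ·) := by rw [h]; simp
  have hg : g ∈ F.filter (e ⊆ ·) := by rw [h]; simp
  rw [Finset.mem_filter] at hf hg
  refine ⟨f, g, hf.1, hg.1, hne, hf.2, hg.2, fun k hk hek => ?_⟩
  have : k ∈ F.filter (e ⊆ ·) := Finset.mem_filter.2 ⟨hk, hek⟩
  rw [h] at this
  simpa using this

lemma exists_other_face {e f : Finset V} (he : e ∈ edges F) (hf : f ∈ F) (hef : e ⊆ f) :
    ∃ g ∈ F, g ≠ f ∧ e ⊆ g ∧ ∀ h ∈ F, e ⊆ h → h = f ∨ h = g := by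
  obtain ⟨a, b, ha, hb, hab, hea, heb, H⟩ := hF.exists_two_faces he
  rcases H f hf hef with rfl | rfl
  · exact ⟨b, hb, hab.symm, heb, H⟩
  · exact ⟨a, ha, hab, hea, fun h hh heh => (H h hh heh).symm⟩

lemma exists_face (v : V) : ∃ f ∈ F, v ∈ f := by
  obtain ⟨⟨f, hf⟩⟩ := (hF.face_cycle v).nonempty
  exact ⟨f.1, f.2, hf⟩

lemma exists_mem : ∃ f, f ∈ F := by
  obtain ⟨f⟩ := hF.connected.nonempty
  exact ⟨f.1, f.2⟩

/-- Induction over the faces, across the edges. -/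
lemma face_induction {P : Finset V → Prop}
    (h : ∀ f ∈ F, ∀ g ∈ F, f ≠ g → (f ∩ g).card = 2 → P f → P g) {f : Finset V} (hf : f ∈ F)
    (hPf : P f) {g : Finset V} (hg : g ∈ F) : P g :=
  connected_induction hF.connected (P := fun f => P f.1)
    (fun a b hab => h a.1 a.2 b.1 b.2 (fun hh => hab.1 (Subtype.ext hh)) hab.2)
    (a := ⟨f, hf⟩) hPf ⟨g, hg⟩

/-- Induction over the faces at a vertex, across the edges at this vertex. -/
lemma star_induction {v : V} {P : Finset V → Prop}
    (h : ∀ f ∈ F, ∀ g ∈ F, v ∈ f → v ∈ g → f ≠ g → (f ∩ g).card = 2 → P f → P g) {f : Finset V}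
    (hf : f ∈ F) (hvf : v ∈ f) (hPf : P f) {g : Finset V} (hg : g ∈ F) (hvg : v ∈ g) : P g :=
  connected_induction (hF.face_cycle v) (P := fun f => P f.1.1)
    (fun a b hab => h a.1.1 a.1.2 b.1.1 b.1.2 a.2 b.2
      (fun hh => hab.1 (Subtype.ext hh)) hab.2)
    (a := ⟨⟨f, hf⟩, hvf⟩) hPf ⟨⟨g, hg⟩, hvg⟩

/-- Double counting of the incident pairs of an edge and a face. -/
lemma card_edges : 2 * (edges F).card = 3 * F.card := by
  have h1 : ∑ e ∈ edges F, (F.filter fun f => e ⊆ f).card = 2 * (edges F).card := by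
    rw [Finset.sum_congr rfl hF.two_faces, Finset.sum_const, smul_eq_mul, mul_comm]
  have h2 : ∑ f ∈ F, ((edges F).filter fun e => e ⊆ f).card = 3 * F.card := by
    rw [Finset.sum_congr rfl (g := fun _ => 3), Finset.sum_const, smul_eq_mul, mul_comm]
    intro f hf
    have : (edges F).filter (fun e => e ⊆ f) = f.powersetCard 2 := by
      ext e
      simp only [Finset.mem_filter, mem_edges_iff, Finset.mem_powersetCard]
      exact ⟨fun h => ⟨h.2, h.1.choose_spec.2.2⟩, fun h => ⟨⟨f, hf, h⟩, h.1⟩⟩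
    rw [this, Finset.card_powersetCard, hF.card_three f hf]
    rfl
  rw [← h1, ← h2]
  exact Finset.sum_card_bipartiteAbove_eq_sum_card_bipartiteBelow _

lemma card_mul_eq [Fintype V] {q : ℕ} (hq : IsOfType3 F q) : q * Fintype.card V = 3 * F.card := by
  have h1 : ∑ v : V, (F.filter fun f => v ∈ f).card = q * Fintype.card V := by
    rw [Finset.sum_congr rfl fun v _ => hq v, Finset.sum_const, smul_eq_mul, mul_comm,
      Finset.card_univ]
  have h2 : ∑ f ∈ F, (Finset.univ.filter fun v => v ∈ f).card = 3 * F.card := by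
    rw [Finset.sum_congr rfl (g := fun _ => 3), Finset.sum_const, smul_eq_mul, mul_comm]
    intro f hf
    rw [Finset.filter_univ_mem, hF.card_three f hf]
  rw [← h1, ← h2]
  exact Finset.sum_card_bipartiteAbove_eq_sum_card_bipartiteBelow _

end IsTriangulatedSurface

/-! ### The chain complex over `ZMod 2` -/

lemma vertexEdge_dot (x : {e // e ∈ edges F} → ZMod 2) (v : V) :
    vertexEdgeMatrix F v ⬝ᵥ x = ∑ e, if v ∈ e.1 then x e else 0 := by
  simp [dotProduct, vertexEdgeMatrix]

lemma faceEdge_dot (x : {e // e ∈ edges F} → ZMod 2) (f : {f // f ∈ F}) :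
    faceEdgeMatrix F f ⬝ᵥ x = ∑ e, if e.1 ⊆ f.1 then x e else 0 := by
  simp [dotProduct, faceEdgeMatrix]

lemma exists_other_of_sum_eq_zero {E : Type*} [Fintype E] {x : E → ZMod 2} {p : E → Prop}
    [DecidablePred p] (h : ∑ e, (if p e then x e else 0) = 0) {e : E} (hp : p e) (hx : x e ≠ 0) :
    ∃ e', e' ≠ e ∧ p e' ∧ x e' ≠ 0 := by
  by_contra! H
  rw [Finset.sum_eq_single e, if_pos hp] at h
  · exact hx h
  · intro e' _ hne
    split_ifs with hp'
    · exact H e' hne hp'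
    · rfl
  · simp

/-- The boundary of a 2-chain at an edge sees only the two faces there; it vanishes exactly when the
chain agrees on them. -/
lemma faceEdge_sum (hF : IsTriangulatedSurface F) (y : {f // f ∈ F} → ZMod 2)
    (e : {e // e ∈ edges F}) {f g : {f // f ∈ F}} (hfg : f ≠ g) (hf : e.1 ⊆ f.1) (hg : e.1 ⊆ g.1) :
    ∑ h, y h * faceEdgeMatrix F h e = y f + y g := by
  rw [← Finset.sum_pair hfg]
  symm
  apply Finset.sum_subset_zero_on_sdiff (Finset.subset_univ _)
  · intro h hh
    simp only [Finset.mem_sdiff, Finset.mem_univ, true_and, Finset.mem_insert,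
      Finset.mem_singleton, not_or] at hh
    simp only [faceEdgeMatrix, Matrix.of_apply]
    rw [if_neg, mul_zero]
    intro heh
    obtain ⟨g', -, -, -, H⟩ := hF.exists_other_face e.2 f.2 hf
    have h1 := (H g g.2 hg).resolve_left fun hh => hfg (Subtype.ext hh.symm)
    rcases H h h.2 heh with h2 | h2
    · exact hh.1 (Subtype.ext h2)
    · exact hh.2 (Subtype.ext (h2.trans h1.symm))
  · intro h hh
    have : e.1 ⊆ h.1 := by
      rcases Finset.mem_insert.1 hh with rfl | hh
      · exact hf
      · rw [Finset.mem_singleton.1 hh]; exact hg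
    simp [faceEdgeMatrix, this]

/-- A triangle has two edges at each of its vertices and none at any other vertex. These are counted
as all its edges minus those avoiding `v`. -/
lemma vertexEdge_mul_faceEdge (hF : IsTriangulatedSurface F) :
    vertexEdgeMatrix F * (faceEdgeMatrix F).transpose = 0 := by
  ext v f
  have h1 : (vertexEdgeMatrix F * (faceEdgeMatrix F).transpose) v f =
      ∑ e : {e // e ∈ edges F}, if v ∈ e.1 ∧ e.1 ⊆ f.1 then (1 : ZMod 2) else 0 := by
    simp only [Matrix.mul_apply, vertexEdgeMatrix, faceEdgeMatrix, Matrix.of_apply,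
      Matrix.transpose_apply]
    refine Finset.sum_congr rfl fun e _ => ?_
    split_ifs <;> simp_all
  rw [h1, Finset.sum_coe_sort (edges F) (fun e => if v ∈ e ∧ e ⊆ f.1 then (1 : ZMod 2) else 0),
    Finset.sum_boole]
  have h2 : (edges F).filter (fun e => v ∈ e ∧ e ⊆ f.1) = (f.1.powersetCard 2).filter (v ∈ ·) := by
    ext e
    simp only [Finset.mem_filter, mem_edges_iff, Finset.mem_powersetCard]
    exact ⟨fun h => ⟨⟨h.2.2, h.1.choose_spec.2.2⟩, h.2.1⟩,
      fun h => ⟨⟨f.1, f.2, h.1⟩, h.2, h.1.1⟩⟩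
  rw [h2]
  have h3 := Finset.card_filter_add_card_filter_not (s := f.1.powersetCard 2) (fun e => v ∈ e)
  have h4 : (f.1.powersetCard 2).filter (v ∉ ·) = (f.1.erase v).powersetCard 2 := by
    ext e
    simp only [Finset.mem_filter, Finset.mem_powersetCard, Finset.subset_erase]
    tauto
  rw [h4, Finset.card_powersetCard, Finset.card_powersetCard, hF.card_three _ f.2] at h3
  by_cases hv : v ∈ f.1
  · rw [Finset.card_erase_of_mem hv, hF.card_three _ f.2] at h3
    have : ((f.1.powersetCard 2).filter (v ∈ ·)).card = 2 := by
      have h5 : Nat.choose 3 2 = 3 := rfl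
      have h6 : Nat.choose (3 - 1) 2 = 1 := rfl
      omega
    rw [this]; rfl
  · rw [Finset.erase_eq_of_notMem hv, hF.card_three _ f.2] at h3
    have : ((f.1.powersetCard 2).filter (v ∈ ·)).card = 0 := by omega
    rw [this]; rfl

/-- The hypotheses say that the left kernel is the line spanned by the all-ones vector. -/
lemma rank_add_one {R E : Type*} [Fintype R] [Fintype E] [DecidableEq E] [Nonempty R]
    (H : Matrix R E (ZMod 2)) (h1 : ∀ e, ∑ r, H r e = 0)
    (h2 : ∀ x : R → ZMod 2, (∀ e, ∑ r, x r * H r e = 0) → ∀ r r', x r = x r') :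
    H.rank + 1 = Fintype.card R := by
  rw [← Matrix.rank_transpose, add_comm]
  have h3 := LinearMap.finrank_range_add_finrank_ker H.transpose.mulVecLin
  rw [Module.finrank_fintype_fun_eq_card] at h3
  have hmem : ∀ x : R → ZMod 2, x ∈ LinearMap.ker H.transpose.mulVecLin ↔
      ∀ e, ∑ r, x r * H r e = 0 := by
    intro x
    simp only [LinearMap.mem_ker, Matrix.mulVecLin_apply, funext_iff, Matrix.mulVec, dotProduct,
      Matrix.transpose_apply, Pi.zero_apply]
    refine forall_congr' fun e => ?_
    simp only [mul_comm]
  have hker : LinearMap.ker H.transpose.mulVecLin = Submodule.span (ZMod 2) {fun _ => 1} := by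
    ext x
    rw [hmem, Submodule.mem_span_singleton]
    constructor
    · intro hx
      obtain ⟨r⟩ := ‹Nonempty R›
      refine ⟨x r, ?_⟩
      funext r'
      simpa using h2 x hx r r'
    · rintro ⟨c, rfl⟩ e
      simp only [Pi.smul_apply, smul_eq_mul, mul_one]
      rw [← Finset.mul_sum, h1, mul_zero]
  have h4 : Module.finrank (ZMod 2) (LinearMap.ker H.transpose.mulVecLin) = 1 := by
    rw [hker]
    apply finrank_span_singleton
    intro h
    obtain ⟨r⟩ := ‹Nonempty R›
    exact one_ne_zero (congrFun h r)
  rw [Matrix.rank, ← h3, h4, add_comm]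

/-- A function on the vertices with zero coboundary is constant on each face, hence everywhere by
connectedness. -/
lemma rank_vertexEdge [Fintype V] (hF : IsTriangulatedSurface F) :
    (vertexEdgeMatrix F).rank + 1 = Fintype.card V := by
  obtain ⟨f, hf⟩ := hF.exists_mem
  have : Nonempty V := by
    obtain ⟨v, -⟩ := Finset.card_pos.1 (by rw [hF.card_three f hf]; norm_num : 0 < f.card)
    exact ⟨v⟩
  have hsum : ∀ (x : V → ZMod 2) (e : {e // e ∈ edges F}),
      ∑ v, x v * vertexEdgeMatrix F v e = ∑ v ∈ e.1, x v := by
    intro x e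
    simp [vertexEdgeMatrix, Finset.sum_ite_mem]
  apply rank_add_one
  · intro e
    have := hsum (fun _ => 1) e
    simp only [one_mul] at this
    rw [this, Finset.sum_const, card_of_mem_edges e.2]
    rfl
  · intro x hx
    have hface : ∀ f ∈ F, ∀ u ∈ f, ∀ v ∈ f, x u = x v := by
      intro f hf u hu v hv
      by_cases huv : u = v
      · rw [huv]
      · have he : ({u, v} : Finset V) ∈ edges F := mem_edges_iff.2
          ⟨f, hf, by simp [Finset.insert_subset_iff, hu, hv], Finset.card_pair huv⟩
        have := hx ⟨_, he⟩
        rw [hsum, Finset.sum_pair huv] at this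
        exact CharTwo.add_eq_zero.1 this
    intro u v
    obtain ⟨f, hf, huf⟩ := hF.exists_face u
    obtain ⟨g, hg, hvg⟩ := hF.exists_face v
    have := hF.face_induction (P := fun g => ∀ v ∈ g, x u = x v) ?_ hf (hface f hf u huf) hg
    · exact this v hvg
    · intro f hf g hg _ hfg hP v hv
      obtain ⟨w, hw⟩ := Finset.card_pos.1 (by rw [hfg]; norm_num : 0 < (f ∩ g).card)
      rw [Finset.mem_inter] at hw
      rw [hP w hw.1, hface g hg w hw.2 v hv]

/-- A 2-cycle takes equal values on adjacent faces, hence is constant because the dual graph is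
connected. -/
lemma rank_faceEdge (hF : IsTriangulatedSurface F) : (faceEdgeMatrix F).rank + 1 = F.card := by
  obtain ⟨f, hf⟩ := hF.exists_mem
  have : Nonempty {f // f ∈ F} := ⟨⟨f, hf⟩⟩
  rw [← Fintype.card_coe F]
  apply rank_add_one
  · intro e
    obtain ⟨f, g, hf, hg, hne, hef, heg, -⟩ := hF.exists_two_faces e.2
    have := faceEdge_sum hF (fun _ => 1) e (f := ⟨f, hf⟩) (g := ⟨g, hg⟩)
      (fun h => hne (congrArg Subtype.val h)) hef heg
    simp only [one_mul] at this
    rw [this]; rfl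
  · intro y hy f g
    refine connected_induction hF.connected (P := fun g => y f = y g) ?_ rfl g
    intro a b hab ha
    have he : a.1 ∩ b.1 ∈ edges F := mem_edges_iff.2 ⟨a, a.2, Finset.inter_subset_left, hab.2⟩
    have := hy ⟨_, he⟩
    rw [faceEdge_sum hF y ⟨_, he⟩ hab.1 Finset.inter_subset_left Finset.inter_subset_right] at this
    rw [ha]
    exact CharTwo.add_eq_zero.1 this

end Surface
-- Short cycles and cocycles, and the distance of the code
section Surface

variable {V : Type*} [DecidableEq V] {F : Finset (Finset V)}

/-- The number of nonzero entries of a vector. -/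
def hammingSize {E : Type*} [Fintype E] (x : E → ZMod 2) : ℕ :=
  (Finset.univ.filter fun e => x e ≠ 0).card

lemma hammingSize_left_le {E : Type*} [Fintype E] (a b : E → ZMod 2) :
    hammingSize a ≤ pairWeight a b :=
  Finset.card_le_card fun e => by simp only [Finset.mem_filter]; tauto

lemma hammingSize_right_le {E : Type*} [Fintype E] (a b : E → ZMod 2) :
    hammingSize b ≤ pairWeight a b :=
  Finset.card_le_card fun e => by simp only [Finset.mem_filter]; tauto

lemma pairWeight_zero_left {E : Type*} [Fintype E] (b : E → ZMod 2) :
    pairWeight 0 b = hammingSize b := by simp [pairWeight, hammingSize]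

/-- A nonzero cycle contains three distinct edges `uv`, `uw`, `vw'`. -/
lemma exists_three_edges {x : {e // e ∈ edges F} → ZMod 2} (hx : x ∈ checkKer (vertexEdgeMatrix F))
    (hne : x ≠ 0) : ∃ e e' e'' : {e // e ∈ edges F}, ∃ u v w w' : V,
      u ≠ v ∧ u ≠ w ∧ v ≠ w' ∧ e.1 = {u, v} ∧ e'.1 = {u, w} ∧ e''.1 = {v, w'} ∧ v ≠ w ∧ u ≠ w' ∧
      x e ≠ 0 ∧ x e' ≠ 0 ∧ x e'' ≠ 0 := by
  obtain ⟨e, he⟩ := Function.ne_iff.1 hne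
  have key : ∀ e : {e // e ∈ edges F}, ∀ v ∈ e.1, x e ≠ 0 →
      ∃ e' : {e // e ∈ edges F}, e' ≠ e ∧ v ∈ e'.1 ∧ x e' ≠ 0 := by
    intro e v hv hxe
    have := mem_checkKer.1 hx v
    rw [vertexEdge_dot] at this
    exact exists_other_of_sum_eq_zero this hv hxe
  obtain ⟨u, v, huv, he2⟩ := Finset.card_eq_two.1 (card_of_mem_edges e.2)
  obtain ⟨e', hne', hu', hx'⟩ := key e u (by simp [he2]) he
  obtain ⟨e'', hne'', hv'', hx''⟩ := key e v (by simp [he2]) he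
  obtain ⟨w, huw, hw⟩ := exists_eq_pair_of_mem (card_of_mem_edges e'.2) hu'
  obtain ⟨w', hvw, hw'⟩ := exists_eq_pair_of_mem (card_of_mem_edges e''.2) hv''
  refine ⟨e, e', e'', u, v, w, w', huv, huw, hvw, he2, hw, hw', ?_, ?_, he, hx', hx''⟩
  · rintro rfl
    exact hne' (Subtype.ext (hw.trans he2.symm))
  · rintro rfl
    exact hne'' (Subtype.ext (hw'.trans (by rw [he2, Finset.pair_comm])))

lemma pair_ne_pair {a b c d : V} (h1 : a ≠ c) (h2 : a ≠ d) : ({a, b} : Finset V) ≠ {c, d} := by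
  intro h
  have : a ∈ ({c, d} : Finset V) := by rw [← h]; simp
  simp [h1, h2] at this

lemma three_le_hammingSize {x : {e // e ∈ edges F} → ZMod 2}
    (hx : x ∈ checkKer (vertexEdgeMatrix F)) (hne : x ≠ 0) : 3 ≤ hammingSize x := by
  obtain ⟨e, e', e'', u, v, w, w', huv, huw, hvw', he, he', he'', hvw, huw', h1, h2, h3⟩ :=
    exists_three_edges hx hne
  have h12 : e ≠ e' := fun h => by
    rw [h, he', Finset.pair_comm u v] at he
    exact pair_ne_pair huv.symm hvw he.symm
  have h13 : e ≠ e'' := fun h => by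
    rw [h, he''] at he
    exact pair_ne_pair huv huw' he.symm
  have h23 : e' ≠ e'' := fun h => by
    rw [h, he''] at he'
    exact pair_ne_pair huv.symm hvw he'
  have : ({e, e', e''} : Finset {e // e ∈ edges F}).card = 3 := by
    rw [Finset.card_eq_three]; exact ⟨e, e', e'', h12, h13, h23, rfl⟩
  rw [← this]
  apply Finset.card_le_card
  intro d
  simp only [Finset.mem_insert, Finset.mem_singleton, Finset.mem_filter, Finset.mem_univ, true_and]
  rintro (rfl | rfl | rfl) <;> assumption

lemma forall_zmod_three {P : ZMod 3 → Prop} : (∀ i, P i) ↔ P 0 ∧ P 1 ∧ P 2 :=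
  Fin.forall_fin_succ.trans (and_congr Iff.rfl (Fin.forall_fin_two))

lemma exists_zmod_three {P : ZMod 3 → Prop} : (∃ i, P i) ↔ P 0 ∨ P 1 ∨ P 2 :=
  Fin.exists_fin_succ.trans (or_congr Iff.rfl (Fin.exists_fin_two))

/-- The cyclic sequence of three vertices. -/
def triple (u v w : V) : ZMod 3 → V := ![u, v, w]

lemma mem_cycleEdges_three {t : ZMod 3 → V} {e : Finset V} :
    e ∈ cycleEdges t ↔ e = {t 0, t 1} ∨ e = {t 1, t 2} ∨ e = {t 2, t 0} :=
  exists_zmod_three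

lemma isCycle_three_iff {t : ZMod 3 → V} : IsCycle F t ↔
    {t 0, t 1} ∈ edges F ∧ {t 1, t 2} ∈ edges F ∧ {t 2, t 0} ∈ edges F := by
  constructor
  · intro h
    exact ⟨h.edge 0, h.edge 1, h.edge 2⟩
  · rintro ⟨h0, h1, h2⟩
    refine ⟨le_rfl, ?_, forall_zmod_three.2 ⟨h0, h1, h2⟩⟩
    have n0 := ne_of_pair_mem_edges h0
    have n1 := ne_of_pair_mem_edges h1
    have n2 := ne_of_pair_mem_edges h2
    have : ∀ i j, t i = t j → i = j := by
      refine forall_zmod_three.2 ⟨?_, ?_, ?_⟩ <;> refine forall_zmod_three.2 ⟨?_, ?_, ?_⟩ <;>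
        intro h <;> first | rfl | exact absurd h (by assumption) | exact absurd h.symm (by assumption)
    exact fun i j => this i j

open Classical in
/-- The chain of the edges of a closed path. -/
noncomputable def cycleChain (F : Finset (Finset V)) {k : ℕ} (t : ZMod k → V) :
    {e // e ∈ edges F} → ZMod 2 := fun e => if e.1 ∈ cycleEdges t then 1 else 0

lemma cycleChain_ne_zero_iff {k : ℕ} {t : ZMod k → V} {e : {e // e ∈ edges F}} :
    cycleChain F t e ≠ 0 ↔ e.1 ∈ cycleEdges t := by
  simp [cycleChain]

lemma hammingSize_le_three {t : ZMod 3 → V} {x : {e // e ∈ edges F} → ZMod 2}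
    (h : ∀ e, x e ≠ 0 → e.1 ∈ cycleEdges t) : hammingSize x ≤ 3 := by
  unfold hammingSize
  rw [← Finset.card_map (Function.Embedding.subtype _)]
  refine (Finset.card_le_card (t := {{t 0, t 1}, {t 1, t 2}, {t 2, t 0}}) ?_).trans
    Finset.card_le_three
  intro e
  simp only [Finset.mem_map, Finset.mem_filter, Finset.mem_univ, true_and,
    Function.Embedding.subtype_apply, Finset.mem_insert, Finset.mem_singleton]
  rintro ⟨e, he, rfl⟩
  exact mem_cycleEdges_three.1 (h e he)

/-- A nonzero cycle supported on a closed path of length 3 is the chain of this path. -/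
lemma eq_cycleChain_of_support {t : ZMod 3 → V} {x : {e // e ∈ edges F} → ZMod 2}
    (hx : x ∈ checkKer (vertexEdgeMatrix F)) (hne : x ≠ 0)
    (h : ∀ e, x e ≠ 0 → e.1 ∈ cycleEdges t) : x = cycleChain F t := by
  have h1 := three_le_hammingSize hx hne
  have h2 : hammingSize (cycleChain F t) ≤ 3 :=
    hammingSize_le_three fun e he => cycleChain_ne_zero_iff.1 he
  have h3 := Finset.eq_of_subset_of_card_le
    (s := Finset.univ.filter fun e => x e ≠ 0)
    (t := Finset.univ.filter fun e => cycleChain F t e ≠ 0) (by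
      intro e
      simp only [Finset.mem_filter, Finset.mem_univ, true_and, cycleChain_ne_zero_iff]
      exact h e) (h2.trans h1)
  funext e
  have h4 := Finset.ext_iff.1 h3 e
  simp only [Finset.mem_filter, Finset.mem_univ, true_and] at h4
  rcases zmod_two_cases (x e) with h5 | h5 <;>
    rcases zmod_two_cases (cycleChain F t e) with h6 | h6 <;> rw [h5, h6] at h4 ⊢ <;> simp at h4

/-- A cycle with three edges is the chain of a closed path of length 3. -/
lemma exists_eq_cycleChain {x : {e // e ∈ edges F} → ZMod 2}
    (hx : x ∈ checkKer (vertexEdgeMatrix F)) (hne : x ≠ 0) (hx3 : hammingSize x ≤ 3) :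
    ∃ t : ZMod 3 → V, IsCycle F t ∧ x = cycleChain F t := by
  obtain ⟨e, e', e'', u, v, w, w', huv, huw, hvw', he, he', he'', hvw, huw', h1, h2, h3⟩ :=
    exists_three_edges hx hne
  have h12 : e ≠ e' := fun h => by
    rw [h, he', Finset.pair_comm u v] at he
    exact pair_ne_pair huv.symm hvw he.symm
  have h13 : e ≠ e'' := fun h => by
    rw [h, he''] at he
    exact pair_ne_pair huv huw' he.symm
  have h23 : e' ≠ e'' := fun h => by
    rw [h, he''] at he'
    exact pair_ne_pair huv.symm hvw he'
  have hcard : ({e, e', e''} : Finset {e // e ∈ edges F}).card = 3 := by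
    rw [Finset.card_eq_three]; exact ⟨e, e', e'', h12, h13, h23, rfl⟩
  have hsupp : ∀ d, x d ≠ 0 → d = e ∨ d = e' ∨ d = e'' := by
    have := Finset.eq_of_subset_of_card_le
      (s := {e, e', e''}) (t := Finset.univ.filter fun e => x e ≠ 0) (by
        intro d
        simp only [Finset.mem_insert, Finset.mem_singleton, Finset.mem_filter, Finset.mem_univ,
          true_and]
        rintro (rfl | rfl | rfl) <;> assumption) (by rw [hcard]; exact hx3)
    intro d hd
    have hmem : d ∈ Finset.univ.filter fun e => x e ≠ 0 := by simpa using hd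
    rw [← this] at hmem
    simpa using hmem
  -- The boundary vanishes at `w`, so a second edge of the support passes through `w`, and only
  -- `e''` can.
  have hww : w = w' := by
    have h4 := mem_checkKer.1 hx w
    rw [vertexEdge_dot] at h4
    obtain ⟨d, hd, hwd, hxd⟩ := exists_other_of_sum_eq_zero (p := fun e => w ∈ e.1) h4 (e := e')
      (by simp [he']) h2
    rcases hsupp d hxd with rfl | rfl | rfl
    · rw [he] at hwd
      simp [huw.symm, hvw.symm] at hwd
    · exact absurd rfl hd
    · rw [he''] at hwd
      simpa [hvw.symm] using hwd
  subst hww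
  refine ⟨triple u v w, isCycle_three_iff.2 ⟨he ▸ e.2, he'' ▸ e''.2, ?_⟩,
    eq_cycleChain_of_support hx hne fun d hd => mem_cycleEdges_three.2 ?_⟩
  · have := e'.2
    rw [he', Finset.pair_comm] at this
    exact this
  · rcases hsupp d hd with rfl | rfl | rfl
    · exact Or.inl he
    · exact Or.inr (Or.inr (by rw [he', Finset.pair_comm]; rfl))
    · exact Or.inr (Or.inl he'')

lemma cycleChain_mem_checkKer {t : ZMod 3 → V} (ht : IsCycle F t) :
    cycleChain F t ∈ checkKer (vertexEdgeMatrix F) := by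
  obtain ⟨h0, h1, h2⟩ := isCycle_three_iff.1 ht
  have n0 := ne_of_pair_mem_edges h0
  have n1 := ne_of_pair_mem_edges h1
  have n2 := ne_of_pair_mem_edges h2
  classical
  have hchain : cycleChain F t =
      Pi.single ⟨_, h0⟩ 1 + Pi.single ⟨_, h1⟩ 1 + Pi.single ⟨_, h2⟩ 1 := by
    have e01 : ({t 0, t 1} : Finset V) ≠ {t 1, t 2} := pair_ne_pair n0 n2.symm
    have e02 : ({t 0, t 1} : Finset V) ≠ {t 2, t 0} := by
      rw [Finset.pair_comm (t 0)]; exact pair_ne_pair n1 n0.symm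
    have e12 : ({t 1, t 2} : Finset V) ≠ {t 2, t 0} := pair_ne_pair n1 n0.symm
    funext e
    by_cases he : e.1 ∈ cycleEdges t
    · have : cycleChain F t e = 1 := if_pos he
      rw [this]
      obtain ⟨e, hh⟩ := e
      rcases mem_cycleEdges_three.1 he with rfl | rfl | rfl <;>
        simp [e01, e02, e12, e01.symm, e02.symm, e12.symm]
    · have : cycleChain F t e = 0 := if_neg he
      rw [this]
      rw [mem_cycleEdges_three] at he
      push Not at he
      simp [Subtype.ext_iff, he]
  rw [hchain]
  refine mem_checkKer.2 fun v => ?_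
  simp only [dotProduct_add, dotProduct_single, mul_one, vertexEdgeMatrix, Matrix.of_apply,
    Finset.mem_insert, Finset.mem_singleton]
  have h11 : (1 : ZMod 2) + 1 = 0 := by decide
  by_cases c0 : v = t 0
  · subst c0; simp [n0, n2.symm, h11]
  · by_cases c1 : v = t 1
    · subst c1; simp [n1, c0, h11]
    · by_cases c2 : v = t 2
      · subst c2; simp [c0, c1, h11]
      · simp [c0, c1, c2]

lemma cycleChain_ne_zero {t : ZMod 3 → V} (ht : IsCycle F t) : cycleChain F t ≠ 0 := by
  intro h
  exact cycleChain_ne_zero_iff.2 (show _ ∈ cycleEdges t from ⟨0, rfl⟩) (congrFun h ⟨_, ht.edge 0⟩)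

lemma mem_rowSpace_faceEdge_iff {x : {e // e ∈ edges F} → ZMod 2} :
    x ∈ rowSpace (faceEdgeMatrix F) ↔
      ∃ y : {f // f ∈ F} → ZMod 2, ∀ e, x e = ∑ f, y f * faceEdgeMatrix F f e := by
  refine (Submodule.mem_span_range_iff_exists_fun (ZMod 2) (v := fun f => faceEdgeMatrix F f)).trans ?_
  refine exists_congr fun y => ?_
  rw [funext_iff]
  refine forall_congr' fun e => ?_
  rw [Finset.sum_apply, eq_comm]
  rfl

/-- A closed path of length 3 is nonseparating if and only if it does not bound over `ZMod 2`. -/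
theorem isNonseparating_iff (hF : IsTriangulatedSurface F) {t : ZMod 3 → V} (ht : IsCycle F t) :
    IsNonseparating F t ↔ cycleChain F t ∉ rowSpace (faceEdgeMatrix F) := by
  constructor
  · intro hns hmem
    obtain ⟨y, hy⟩ := mem_rowSpace_faceEdge_iff.1 hmem
    apply cycleChain_ne_zero ht
    -- Off the path the boundary of `y` is zero, so `y` is constant on the connected cut surface;
    -- then its boundary is zero on the path as well.
    have hconst : ∀ f g, y f = y g := by
      intro f g
      refine connected_induction hns (P := fun g => y f = y g) ?_ rfl g
      intro a b hab ha
      have he : a.1 ∩ b.1 ∈ edges F :=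
        mem_edges_iff.2 ⟨a, a.2, Finset.inter_subset_left, hab.1.2⟩
      have := hy ⟨_, he⟩
      rw [faceEdge_sum hF y ⟨_, he⟩ hab.1.1 Finset.inter_subset_left
        Finset.inter_subset_right] at this
      have h0 : cycleChain F t ⟨_, he⟩ = 0 := if_neg hab.2
      rw [h0] at this
      rw [ha]
      exact CharTwo.add_eq_zero.1 this.symm
    funext e
    obtain ⟨f, g, hf, hg, hne, hef, heg, -⟩ := hF.exists_two_faces e.2
    rw [hy e, faceEdge_sum hF y e (f := ⟨f, hf⟩) (g := ⟨g, hg⟩)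
      (fun h => hne (congrArg Subtype.val h)) hef heg, hconst ⟨f, hf⟩ ⟨g, hg⟩]
    exact CharTwo.add_self_eq_zero _
  · intro hnot
    by_contra hsep
    apply hnot
    obtain ⟨f0, hf0⟩ := hF.exists_mem
    classical
    -- The indicator `y` of one component of the cut surface has its boundary `x` supported on the
    -- path. If `x` is nonzero, it is the whole triangle, which therefore bounds.
    let P : {f // f ∈ F} → Prop := fun f => (cutDualGraph F t).Reachable ⟨f0, hf0⟩ f
    let y : {f // f ∈ F} → ZMod 2 := fun f => if P f then 1 else 0
    let x : {e // e ∈ edges F} → ZMod 2 := fun e => ∑ f, y f * faceEdgeMatrix F f e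
    have hxrow : x ∈ rowSpace (faceEdgeMatrix F) := mem_rowSpace_faceEdge_iff.2 ⟨y, fun _ => rfl⟩
    have hcom : faceEdgeMatrix F * (vertexEdgeMatrix F).transpose = 0 := by
      rw [← Matrix.transpose_transpose (faceEdgeMatrix F), ← Matrix.transpose_mul,
        vertexEdge_mul_faceEdge hF, Matrix.transpose_zero]
    have hxker := rowSpace_le_checkKer hcom hxrow
    suffices x = cycleChain F t from this ▸ hxrow
    apply eq_cycleChain_of_support hxker
    -- With zero boundary the component would be the whole connected surface, so the cut would not
    -- separate.
    · intro hx0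
      apply hsep
      refine connected_of_induction ⟨f0, hf0⟩ fun Q hQ hQ0 => ?_
      have hall : ∀ f, P f := by
        refine connected_induction hF.connected (P := P) ?_ (SimpleGraph.Reachable.refl _)
        intro a b hab ha
        by_contra hb
        have he : a.1 ∩ b.1 ∈ edges F :=
          mem_edges_iff.2 ⟨a, a.2, Finset.inter_subset_left, hab.2⟩
        have hxe : x ⟨_, he⟩ = y a + y b := faceEdge_sum hF y ⟨_, he⟩ hab.1
          Finset.inter_subset_left Finset.inter_subset_right
        have hya : y a = 1 := if_pos ha
        have hyb : y b = 0 := if_neg hb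
        rw [hx0, hya, hyb] at hxe
        simp at hxe
      intro f
      obtain ⟨w⟩ := hall f
      have hwalk : ∀ a b, (cutDualGraph F t).Walk a b → Q a → Q b := by
        intro a b w
        induction w with
        | nil => exact id
        | cons h _ ih => exact fun ha => ih (hQ _ _ h ha)
      exact hwalk _ _ w hQ0
    · intro e he
      by_contra hec
      apply he
      obtain ⟨f, g, hf, hg, hne, hef, heg, -⟩ := hF.exists_two_faces e.2
      have hne' : (⟨f, hf⟩ : {f // f ∈ F}) ≠ ⟨g, hg⟩ := fun h => hne (congrArg Subtype.val h)
      have hinter := hF.inter_eq_of_subset hf hg hne (card_of_mem_edges e.2) hef heg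
      have hadj : (cutDualGraph F t).Adj ⟨f, hf⟩ ⟨g, hg⟩ :=
        ⟨⟨hne', by rw [hinter]; exact card_of_mem_edges e.2⟩, by rw [hinter]; exact hec⟩
      have hxe : x e = y ⟨f, hf⟩ + y ⟨g, hg⟩ := faceEdge_sum hF y e hne' hef heg
      have hP : P ⟨f, hf⟩ ↔ P ⟨g, hg⟩ :=
        ⟨fun h => h.trans hadj.reachable, fun h => h.trans hadj.symm.reachable⟩
      have hyy : y ⟨f, hf⟩ = y ⟨g, hg⟩ := by simp only [y, hP]
      rw [hxe, hyy]
      exact CharTwo.add_self_eq_zero _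

/-- A nonzero cocycle has at least four edges if all vertices have degree at least 4. -/
theorem four_le_hammingSize (hF : IsTriangulatedSurface F) {q : ℕ} (hq : IsOfType3 F q)
    (hq4 : 4 ≤ q) {x : {e // e ∈ edges F} → ZMod 2} (hx : x ∈ checkKer (faceEdgeMatrix F))
    (hne : x ≠ 0) : 4 ≤ hammingSize x := by
  obtain ⟨e, he⟩ := Function.ne_iff.1 hne
  have key : ∀ e : {e // e ∈ edges F}, ∀ f ∈ F, e.1 ⊆ f → x e ≠ 0 →
      ∃ e' : {e // e ∈ edges F}, e' ≠ e ∧ e'.1 ⊆ f ∧ x e' ≠ 0 := by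
    intro e f hf hef hxe
    have := mem_checkKer.1 hx ⟨f, hf⟩
    rw [faceEdge_dot] at this
    exact exists_other_of_sum_eq_zero this hef hxe
  have uniq : ∀ {f g : Finset V} {e e' : {e // e ∈ edges F}}, f ∈ F → g ∈ F → f ≠ g →
      e.1 ⊆ f → e.1 ⊆ g → e'.1 ⊆ f → e'.1 ⊆ g → e' = e := by
    intro f g e e' hf hg hfg h1 h2 h3 h4
    apply Subtype.ext
    rw [← hF.inter_eq_of_subset hf hg hfg (card_of_mem_edges e.2) h1 h2,
      hF.inter_eq_of_subset hf hg hfg (card_of_mem_edges e'.2) h3 h4]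
  obtain ⟨f, g, hf, hg, hfg, hef, heg, H⟩ := hF.exists_two_faces e.2
  obtain ⟨e1, hne1, hef1, hx1⟩ := key e f hf hef he
  obtain ⟨e2, hne2, heg2, hx2⟩ := key e g hg heg he
  have h12 : e1 ≠ e2 := by
    rintro rfl
    exact hne1 (uniq hf hg hfg hef heg hef1 heg2)
  -- A cocycle enters and leaves each face through edges of its support. With just three edges, the
  -- third face `h` closes this path up around a common vertex `v`.
  by_contra hlt
  have hcard : ({e, e1, e2} : Finset {e // e ∈ edges F}).card = 3 := by
    rw [Finset.card_eq_three]; exact ⟨e, e1, e2, hne1.symm, hne2.symm, h12, rfl⟩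
  have hsupp : ∀ d, x d ≠ 0 → d = e ∨ d = e1 ∨ d = e2 := by
    have := Finset.eq_of_subset_of_card_le
      (s := {e, e1, e2}) (t := Finset.univ.filter fun e => x e ≠ 0) (by
        intro d
        simp only [Finset.mem_insert, Finset.mem_singleton, Finset.mem_filter, Finset.mem_univ,
          true_and]
        rintro (rfl | rfl | rfl) <;> assumption) (by
          rw [hcard]; unfold hammingSize at hlt; omega)
    intro d hd
    have hmem : d ∈ Finset.univ.filter fun e => x e ≠ 0 := by simpa using hd
    rw [← this] at hmem
    simpa using hmem
  obtain ⟨h, hh, hhf, he1h, H1⟩ := hF.exists_other_face e1.2 hf hef1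
  have hhg : h ≠ g := by
    rintro rfl
    exact hne1 (uniq hf hg hfg hef heg hef1 he1h)
  have he2h : e2.1 ⊆ h := by
    obtain ⟨d, hd, hdh, hxd⟩ := key e1 h hh he1h hx1
    rcases hsupp d hxd with rfl | rfl | rfl
    · rcases H h hh hdh with rfl | rfl
      · exact absurd rfl hhf
      · exact absurd rfl hhg
    · exact absurd rfl hd
    · exact hdh
  have hH2 : ∀ k ∈ F, e2.1 ⊆ k → k = g ∨ k = h := by
    obtain ⟨k, hk, hkg, hek, H2⟩ := hF.exists_other_face e2.2 hg heg2
    have := (H2 h hh he2h).resolve_left hhg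
    rw [this]
    exact H2
  -- Two edges of the same triangle `h` share a vertex.
  obtain ⟨v, hv⟩ : (e1.1 ∩ e2.1).Nonempty := by
    rw [← Finset.card_pos]
    have h1 := Finset.card_union_add_card_inter e1.1 e2.1
    have h2 := Finset.card_le_card (Finset.union_subset he1h he2h)
    rw [hF.card_three h hh] at h2
    rw [card_of_mem_edges e1.2, card_of_mem_edges e2.2] at h1
    omega
  rw [Finset.mem_inter] at hv
  have hve : v ∈ e.1 := by
    rw [← hF.inter_eq_of_subset hf hg hfg (card_of_mem_edges e.2) hef heg]
    exact Finset.mem_inter.2 ⟨hef1 hv.1, heg2 hv.2⟩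
  -- a face has only two edges at each vertex
  have two : ∀ {k : Finset V} {a b : {e // e ∈ edges F}} {p : Finset V}, k ∈ F → a ≠ b →
      a.1 ⊆ k → b.1 ⊆ k → v ∈ a.1 → v ∈ b.1 → p ⊆ k → p.card = 2 → v ∈ p → p = a.1 ∨ p = b.1 := by
    intro k a b p hk hab hak hbk hva hvb hpk hp hvp
    obtain ⟨a', hva', ha'⟩ := exists_eq_pair_of_mem (card_of_mem_edges a.2) hva
    obtain ⟨b', hvb', hb'⟩ := exists_eq_pair_of_mem (card_of_mem_edges b.2) hvb
    obtain ⟨p', hvp', hp'⟩ := exists_eq_pair_of_mem hp hvp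
    have hab' : a' ≠ b' := fun h => hab (Subtype.ext (by rw [ha', hb', h]))
    have hkk : {v, a', b'} = k := by
      apply Finset.eq_of_subset_of_card_le
      · intro z
        simp only [Finset.mem_insert, Finset.mem_singleton]
        rintro (rfl | rfl | rfl)
        · exact hak hva
        · exact hak (by rw [ha']; simp)
        · exact hbk (by rw [hb']; simp)
      · rw [hF.card_three k hk, Finset.card_eq_three.2 ⟨v, a', b', hva', hvb', hab', rfl⟩]
    have : p' ∈ k := hpk (by rw [hp']; simp)
    rw [← hkk] at this
    simp only [Finset.mem_insert, Finset.mem_singleton] at this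
    rcases this with rfl | rfl | rfl
    · exact absurd rfl hvp'
    · exact Or.inl (by rw [hp', ha'])
    · exact Or.inr (by rw [hp', hb'])
  -- Crossing any edge at `v` from one of these three faces leads to another of them, and the star
  -- of `v` is connected; so `v` has degree at most 3.
  have hstar : F.filter (v ∈ ·) ⊆ {f, g, h} := by
    intro k hk
    rw [Finset.mem_filter] at hk
    simp only [Finset.mem_insert, Finset.mem_singleton]
    refine hF.star_induction (P := fun k => k = f ∨ k = g ∨ k = h) ?_ hf (hef hve) (Or.inl rfl)
      hk.1 hk.2
    rintro a ha b hb hva hvb hab hcard2 hor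
    have hvab : v ∈ a ∩ b := Finset.mem_inter.2 ⟨hva, hvb⟩
    have hsub : a ∩ b ⊆ a := Finset.inter_subset_left
    have hsubb : a ∩ b ⊆ b := Finset.inter_subset_right
    rcases hor with rfl | rfl | rfl
    · rcases two ha hne1.symm hef hef1 hve hv.1 hsub hcard2 hvab with h' | h' <;> rw [h'] at hsubb
      · rcases H b hb hsubb with h | h <;> simp [h]
      · rcases H1 b hb hsubb with h | h <;> simp [h]
    · rcases two ha hne2.symm heg heg2 hve hv.2 hsub hcard2 hvab with h' | h' <;> rw [h'] at hsubb
      · rcases H b hb hsubb with h | h <;> simp [h]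
      · rcases hH2 b hb hsubb with h | h <;> simp [h]
    · rcases two ha h12 he1h he2h hv.1 hv.2 hsub hcard2 hvab with h' | h' <;> rw [h'] at hsubb
      · rcases H1 b hb hsubb with h | h <;> simp [h]
      · rcases hH2 b hb hsubb with h | h <;> simp [h]
  have := Finset.card_le_card hstar
  rw [hq v] at this
  have := this.trans Finset.card_le_three
  omega

/-- The parameters of the homological code of a surface triangulated with vertices of degree at
least 4, where `k = 2 - χ`. -/
theorem givesCode_of_surface [Fintype V] (hF : IsTriangulatedSurface F) {q : ℕ}
    (hq : IsOfType3 F q) (hq4 : 4 ≤ q) {n k : ℕ} (hn : (edges F).card = n)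
    (hk : Fintype.card V + F.card + k = n + 2) (hk0 : 0 < k) :
    (∃ δ, 3 ≤ δ ∧ GivesCode F n k δ) ∧
      (GivesCode F n k 3 ↔ ∃ t : ZMod 3 → V, IsCycle F t ∧ IsNonseparating F t) := by
  have h0 := vertexEdge_mul_faceEdge hF
  have hcard : Fintype.card {e // e ∈ edges F} = n := by rw [Fintype.card_coe, hn]
  have hr1 := rank_vertexEdge hF
  have hr2 := rank_faceEdge hF
  have hk' : k + (vertexEdgeMatrix F).rank + (faceEdgeMatrix F).rank =
      Fintype.card {e // e ∈ edges F} := by omega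
  have hdim := finrank_codeSpace h0 hk'
  have hcode : ∀ δ, GivesCode F n k δ ↔
      IsLeast {w | ∃ a b, IsLogical (vertexEdgeMatrix F) (faceEdgeMatrix F) a b ∧
        pairWeight a b = w} δ := by
    intro δ
    rw [GivesCode, isStabilizerCode_iff h0]
    exact ⟨fun h => h.2.2.2, fun h => ⟨h0, hcard, hdim, h⟩⟩
  -- A nonzero `X` part already costs weight 4; so weight 3 is possible only for a pure `Z` operator
  -- on a nonbounding cycle.
  have hlog : ∀ a b, IsLogical (vertexEdgeMatrix F) (faceEdgeMatrix F) a b →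
      4 ≤ pairWeight a b ∨ (3 ≤ hammingSize b ∧ b ∉ rowSpace (faceEdgeMatrix F)) := by
    rintro a b ⟨ha, hb, hab⟩
    by_cases ha0 : a = 0
    · right
      have hb' : b ∉ rowSpace (faceEdgeMatrix F) := fun h => hab ⟨ha0 ▸ zero_mem _, h⟩
      exact ⟨three_le_hammingSize hb fun h => hb' (h ▸ zero_mem _), hb'⟩
    · left
      exact (four_le_hammingSize hF hq hq4 ha ha0).trans (hammingSize_left_le a b)
  have hlb : ∀ w ∈ {w | ∃ a b, IsLogical (vertexEdgeMatrix F) (faceEdgeMatrix F) a b ∧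
        pairWeight a b = w}, 3 ≤ w := by
    rintro w ⟨a, b, hab, rfl⟩
    rcases hlog a b hab with h | h
    · omega
    · exact h.1.trans (hammingSize_right_le a b)
  have hlogical : ∀ b ∈ checkKer (vertexEdgeMatrix F), b ∉ rowSpace (faceEdgeMatrix F) →
      IsLogical (vertexEdgeMatrix F) (faceEdgeMatrix F) 0 b :=
    fun b hb hb' => ⟨zero_mem _, hb, fun h => hb' h.2⟩
  constructor
  · obtain ⟨b, hb, hb'⟩ := exists_notMem_rowSpace hk' hk0
    have hne : {w | ∃ a b, IsLogical (vertexEdgeMatrix F) (faceEdgeMatrix F) a b ∧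
        pairWeight a b = w}.Nonempty := ⟨_, 0, b, hlogical b hb hb', rfl⟩
    refine ⟨_, hlb _ (Nat.sInf_mem hne), (hcode _).2 ⟨Nat.sInf_mem hne, fun w hw => Nat.sInf_le hw⟩⟩
  · rw [hcode]
    constructor
    · rintro ⟨⟨a, b, hab, hw⟩, -⟩
      rcases hlog a b hab with h | ⟨h3, hb'⟩
      · omega
      · obtain ⟨t, ht, rfl⟩ := exists_eq_cycleChain hab.2.1 (fun h => hb' (h ▸ zero_mem _))
          ((hammingSize_right_le a b).trans hw.le)
        exact ⟨t, ht, (isNonseparating_iff hF ht).2 hb'⟩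
    · rintro ⟨t, ht, hns⟩
      have hl := hlogical _ (cycleChain_mem_checkKer ht) ((isNonseparating_iff hF ht).1 hns)
      refine ⟨⟨0, _, hl, ?_⟩, hlb⟩
      apply le_antisymm
      · rw [pairWeight_zero_left]
        exact hammingSize_le_three fun e he => cycleChain_ne_zero_iff.1 he
      · exact hlb _ ⟨0, _, hl, rfl⟩

end Surface
section Surface

variable {V : Type*} [DecidableEq V] {F : Finset (Finset V)}

/-! ### Nonseparating triangles -/

/-- The neighbours of a vertex. -/
def neighbors [Fintype V] (F : Finset (Finset V)) (v : V) : Finset V :=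
  Finset.univ.filter fun u => ({v, u} : Finset V) ∈ edges F

lemma mem_neighbors [Fintype V] {u v : V} :
    u ∈ neighbors F v ↔ ({v, u} : Finset V) ∈ edges F := by simp [neighbors]

lemma mem_neighbors_comm [Fintype V] {u v : V} : u ∈ neighbors F v ↔ v ∈ neighbors F u := by
  rw [mem_neighbors, mem_neighbors, Finset.pair_comm]

lemma pair_subset_iff {u v : V} {f : Finset V} : ({u, v} : Finset V) ⊆ f ↔ u ∈ f ∧ v ∈ f := by
  simp [Finset.insert_subset_iff]

lemma pair_mem_edges {f : Finset V} (hf : f ∈ F) {u v : V} (hu : u ∈ f) (hv : v ∈ f)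
    (huv : u ≠ v) : ({u, v} : Finset V) ∈ edges F :=
  mem_edges_iff.2 ⟨f, hf, pair_subset_iff.2 ⟨hu, hv⟩, Finset.card_pair huv⟩

/-- Each edge at `v` lies on two faces, and each face at `v` has two edges at `v`. -/
lemma card_neighbors [Fintype V] (hF : IsTriangulatedSurface F) {q : ℕ} (hq : IsOfType3 F q)
    (v : V) : (neighbors F v).card = q := by
  have h1 : ∑ u ∈ neighbors F v, ((F.filter (v ∈ ·)).filter fun f => u ∈ f).card =
      2 * (neighbors F v).card := by
    rw [Finset.sum_congr rfl (g := fun _ => 2), Finset.sum_const, smul_eq_mul, mul_comm]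
    intro u hu
    rw [← hF.two_faces _ (mem_neighbors.1 hu), Finset.filter_filter]
    simp only [pair_subset_iff]
  have h2 : ∑ f ∈ F.filter (v ∈ ·), ((neighbors F v).filter fun u => u ∈ f).card = 2 * q := by
    rw [← hq v, Finset.sum_congr rfl (g := fun _ => 2), Finset.sum_const, smul_eq_mul, mul_comm]
    intro f hf
    rw [Finset.mem_filter] at hf
    have : (neighbors F v).filter (fun u => u ∈ f) = f.erase v := by
      ext u
      simp only [Finset.mem_filter, mem_neighbors, Finset.mem_erase]
      exact ⟨fun h => ⟨(ne_of_pair_mem_edges h.1).symm, h.2⟩,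
        fun h => ⟨pair_mem_edges hf.1 hf.2 h.2 h.1.symm, h.2⟩⟩
    rw [this, Finset.card_erase_of_mem hf.2, hF.card_three f hf.1]
  have h3 : 2 * (neighbors F v).card = 2 * q := by
    rw [← h1, ← h2]
    exact Finset.sum_card_bipartiteAbove_eq_sum_card_bipartiteBelow _
  omega

/-- If every triangle were a face, adjacent vertices would have at most two common neighbours, and 7
+ 7 - 2 = 12 means that their neighbourhoods cover everything. For a face `v u u'`, the five
vertices outside the neighbourhood of `v` (`v` itself included) would then all be common neighbours
of `u` and `u'`. -/
lemma exists_nonfacial_triangle [Fintype V] (hF : IsTriangulatedSurface F)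
    (hq : IsOfType3 F 7) (hV : Fintype.card V = 12) :
    ∃ t : ZMod 3 → V, IsCycle F t ∧ {t 0, t 1, t 2} ∉ F := by
  by_contra! H
  have htri : ∀ u v w, v ∈ neighbors F u → w ∈ neighbors F u → w ∈ neighbors F v →
      ({u, v, w} : Finset V) ∈ F := by
    intro u v w huv huw hvw
    exact H (triple u v w) (isCycle_three_iff.2
      ⟨mem_neighbors.1 huv, mem_neighbors.1 hvw, mem_neighbors.1 (mem_neighbors_comm.1 huw)⟩)
  have hcommon : ∀ u v, v ∈ neighbors F u → (neighbors F u ∩ neighbors F v).card ≤ 2 := by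
    intro u v huv
    rw [← hF.two_faces _ (mem_neighbors.1 huv)]
    apply Finset.card_le_card_of_injOn (fun w => {u, v, w})
    · intro w hw
      have hw := Finset.mem_inter.1 (Finset.mem_coe.1 hw)
      exact Finset.mem_coe.2 (Finset.mem_filter.2 ⟨htri u v w huv hw.1 hw.2,
        by simp⟩)
    · intro w hw w' _ hww
      have hw := Finset.mem_inter.1 (Finset.mem_coe.1 hw)
      have : w ∈ ({u, v, w'} : Finset V) := by
        rw [← show ({u, v, w} : Finset V) = {u, v, w'} from hww]; simp
      simp only [Finset.mem_insert, Finset.mem_singleton] at this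
      exact (this.resolve_left (ne_of_pair_mem_edges (mem_neighbors.1 hw.1)).symm).resolve_left
        (ne_of_pair_mem_edges (mem_neighbors.1 hw.2)).symm
  have hcover : ∀ u v w, v ∈ neighbors F u → w ∉ neighbors F u → w ∈ neighbors F v := by
    intro u v w huv hw
    have h1 := Finset.card_union_add_card_inter (neighbors F u) (neighbors F v)
    rw [card_neighbors hF hq, card_neighbors hF hq] at h1
    have h2 := hcommon u v huv
    have h3 : neighbors F u ∪ neighbors F v = Finset.univ := by
      rw [← Finset.card_eq_iff_eq_univ]
      have := Finset.card_le_univ (neighbors F u ∪ neighbors F v)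
      omega
    have h4 := Finset.mem_univ w
    rw [← h3, Finset.mem_union] at h4
    exact h4.resolve_left hw
  obtain ⟨f, hf⟩ := hF.exists_mem
  obtain ⟨v, u, u', huv, hvu', huu', rfl⟩ := Finset.card_eq_three.1 (hF.card_three f hf)
  have h1 : u ∈ neighbors F v := mem_neighbors.2 (pair_mem_edges hf (by simp) (by simp) huv)
  have h2 : u' ∈ neighbors F v := mem_neighbors.2 (pair_mem_edges hf (by simp) (by simp) hvu')
  have h3 : u' ∈ neighbors F u := mem_neighbors.2 (pair_mem_edges hf (by simp) (by simp) huu')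
  have h4 : (neighbors F v)ᶜ ⊆ neighbors F u ∩ neighbors F u' := by
    intro w hw
    rw [Finset.mem_compl] at hw
    exact Finset.mem_inter.2 ⟨hcover v u w h1 hw, hcover v u' w h2 hw⟩
  have h5 := Finset.card_le_card h4
  rw [Finset.card_compl, card_neighbors hF hq, hV] at h5
  have := hcommon u u' h3
  omega

/-- On at most 12 vertices of degree 7, a separating triangle is a face: each side of another
triangle would have at least 5 vertices off the triangle. -/
lemma nonseparating_of_nonfacial [Fintype V] (hF : IsTriangulatedSurface F)
    (hq : IsOfType3 F 7) (hV : Fintype.card V = 12) {t : ZMod 3 → V}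
    (hnf : {t 0, t 1, t 2} ∉ F) : IsNonseparating F t := by
  obtain ⟨f0, hf0⟩ := hF.exists_mem
  refine connected_of_induction ⟨f0, hf0⟩ fun P hP hP0 => ?_
  rintro ⟨f1, hf1⟩
  by_contra hP1
  set T : Finset V := {t 0, t 1, t 2} with hT
  have hTcard : T.card ≤ 3 := Finset.card_le_three
  have hoff : ∀ f ∈ F, ∃ v ∈ f, v ∉ T := by
    intro f hf
    by_contra! hsub
    apply hnf
    rw [← Finset.eq_of_subset_of_card_le hsub (by rw [hF.card_three f hf]; exact hTcard)]
    exact hf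
  -- The cut does not touch the star of a vertex off the triangle, so such a star lies on one side.
  have hstar : ∀ v ∉ T, ∀ f g, ∀ hf : f ∈ F, ∀ hg : g ∈ F, v ∈ f → v ∈ g →
      P ⟨f, hf⟩ → P ⟨g, hg⟩ := by
    intro v hv f g hf hg hvf hvg hPf
    have := hF.star_induction (v := v) (P := fun f => ∀ hf : f ∈ F, P ⟨f, hf⟩) ?_ hf hvf
      (fun _ => hPf) hg hvg
    · exact this hg
    · intro a ha b hb hva hvb hab hcard hPa hb'
      refine hP ⟨a, ha⟩ ⟨b, hb⟩ ⟨⟨fun h => hab (congrArg Subtype.val h), hcard⟩, ?_⟩ (hPa ha)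
      intro hmem
      have hvab := Finset.mem_inter.2 ⟨hva, hvb⟩
      apply hv
      rcases mem_cycleEdges_three.1 hmem with h | h | h <;>
        · rw [show a ∩ b = _ from h] at hvab
          simp only [Finset.mem_insert, Finset.mem_singleton] at hvab
          rcases hvab with h' | h' <;> simp [hT, h']
  obtain ⟨v0, hv0, hv0T⟩ := hoff f0 hf0
  obtain ⟨v1, hv1, hv1T⟩ := hoff f1 hf1
  have hface : ∀ v x, x ∈ insert v (neighbors F v) → ∃ f ∈ F, v ∈ f ∧ x ∈ f := by
    intro v x hx
    rcases Finset.mem_insert.1 hx with rfl | hx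
    · obtain ⟨f, hf, hvf⟩ := hF.exists_face x
      exact ⟨f, hf, hvf, hvf⟩
    · obtain ⟨f, hf, hvx, -⟩ := mem_edges_iff.1 (mem_neighbors.1 hx)
      exact ⟨f, hf, pair_subset_iff.1 hvx⟩
  have hcard : ∀ v, (insert v (neighbors F v)).card = 8 := by
    intro v
    rw [Finset.card_insert_of_notMem, card_neighbors hF hq]
    intro h
    exact ne_of_pair_mem_edges (mem_neighbors.1 h) rfl
  -- A common point off `T` would have its star on both sides. So the closed neighbourhoods share at
  -- most 3 of their 8 + 8 points, and their union exceeds 12.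
  have hinter : insert v0 (neighbors F v0) ∩ insert v1 (neighbors F v1) ⊆ T := by
    intro x hx
    rw [Finset.mem_inter] at hx
    by_contra hxT
    obtain ⟨g0, hg0, hvg0, hxg0⟩ := hface v0 x hx.1
    obtain ⟨g1, hg1, hvg1, hxg1⟩ := hface v1 x hx.2
    exact hP1 (hstar v1 hv1T g1 f1 hg1 hf1 hvg1 hv1 (hstar x hxT g0 g1 hg0 hg1 hxg0 hxg1
      (hstar v0 hv0T f0 g0 hf0 hg0 hv0 hvg0 hP0)))
  have h1 := Finset.card_union_add_card_inter (insert v0 (neighbors F v0))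
    (insert v1 (neighbors F v1))
  have h2 := Finset.card_le_univ (insert v0 (neighbors F v0) ∪ insert v1 (neighbors F v1))
  have h3 := Finset.card_le_card hinter
  rw [hcard, hcard] at h1
  omega

theorem exists_nonseparating_triangle [Fintype V] (hF : IsTriangulatedSurface F)
    (hq : IsOfType3 F 7) (hV : Fintype.card V = 12) :
    ∃ t : ZMod 3 → V, IsCycle F t ∧ IsNonseparating F t := by
  obtain ⟨t, ht, hnf⟩ := exists_nonfacial_triangle hF hq hV
  exact ⟨t, ht, nonseparating_of_nonfacial hF hq hV hnf⟩

end Surface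
section Surface

variable {V : Type*} [DecidableEq V] {F : Finset (Finset V)}

/-! ### Cutting an oriented surface -/

/-- The orientation of the face `f` runs along the edge `ab` from `a` to `b`. -/
def RunsAlong (o : V → V → V → Prop) (a b : V) (f : Finset V) : Prop :=
  ∃ y, o a b y ∧ f = {a, b, y}

namespace IsOrientation

variable {o : V → V → V → Prop} (ho : IsOrientation F o) (hF : IsTriangulatedSurface F)
include ho

lemma coherent' {v a a' b : V} (h : o v a b) (h' : o v a' b) : a = a' :=
  ho.coherent b v a a' (ho.cyclic _ _ _ (ho.cyclic _ _ _ h))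
    (ho.cyclic _ _ _ (ho.cyclic _ _ _ h'))

lemma not_swap {a b c : V} (h : o a b c) : ¬ o a c b := fun h' => by
  rcases ho.exactly_one a b c (ho.face a b c h) with h1 | h1
  · exact h1.2 h'
  · exact h1.2 h

include hF

lemma ne_of {a b c : V} (h : o a b c) : a ≠ b ∧ a ≠ c ∧ b ≠ c := by
  have := hF.card_three _ (ho.face a b c h)
  refine ⟨?_, ?_, ?_⟩ <;> rintro rfl
  · have h2 := Finset.card_le_two (a := a) (b := c)
    simp at this; omega
  · have h2 := Finset.card_le_two (a := b) (b := a)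
    simp at this; omega
  · have h2 := Finset.card_le_two (a := a) (b := b)
    simp at this; omega

omit ho in
lemma exists_third {f : Finset V} (hf : f ∈ F) {v x : V} (hv : v ∈ f) (hx : x ∈ f) (hvx : v ≠ x) :
    ∃ y, y ≠ v ∧ y ≠ x ∧ f = {v, x, y} := by
  have h1 : ((f.erase v).erase x).card = 1 := by
    rw [Finset.card_erase_of_mem (Finset.mem_erase.2 ⟨hvx.symm, hx⟩), Finset.card_erase_of_mem hv,
      hF.card_three f hf]
  obtain ⟨y, hy⟩ := Finset.card_eq_one.1 h1
  have hy' : y ∈ (f.erase v).erase x := by rw [hy]; simp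
  simp only [Finset.mem_erase] at hy'
  refine ⟨y, hy'.2.1, hy'.1, ?_⟩
  rw [← hy, Finset.insert_erase (Finset.mem_erase.2 ⟨hvx.symm, hx⟩), Finset.insert_erase hv]

lemma runsAlong_or {f : Finset V} (hf : f ∈ F) {v x : V} (hv : v ∈ f) (hx : x ∈ f) (hvx : v ≠ x) :
    RunsAlong o v x f ∨ RunsAlong o x v f := by
  obtain ⟨y, -, -, rfl⟩ := exists_third hF hf hv hx hvx
  rcases ho.exactly_one v x y hf with h | h
  · exact Or.inl ⟨y, h.1, rfl⟩
  · exact Or.inr ⟨y, ho.cyclic _ _ _ (ho.cyclic _ _ _ h.1), Finset.insert_comm _ _ _⟩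

lemma not_runsAlong_swap {f : Finset V} {v x : V} (h : RunsAlong o v x f) :
    ¬ RunsAlong o x v f := by
  rintro ⟨z, hz, hfz⟩
  obtain ⟨y, hy, rfl⟩ := h
  have hyz : y = z := by
    have h1 : y ∈ ({x, v, z} : Finset V) := by rw [← hfz]; simp
    have h2 := ho.ne_of hF hy
    simp only [Finset.mem_insert, Finset.mem_singleton] at h1
    rcases h1 with h1 | h1 | h1
    · exact absurd h1.symm h2.2.2
    · exact absurd h1.symm h2.2.1
    · exact h1
  subst hyz
  exact ho.not_swap hy (ho.cyclic _ _ _ hz)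

omit hF in
lemma eq_of_runsAlong {f g : Finset V} {v x : V} (h : RunsAlong o v x f) (h' : RunsAlong o v x g) :
    f = g := by
  obtain ⟨y, hy, rfl⟩ := h
  obtain ⟨z, hz, rfl⟩ := h'
  rw [ho.coherent v x y z hy hz]

/-- Coherence allows each direction of the edge to at most one face, so the two faces there take one
direction each. -/
lemma runsAlong_iff_not {f g : Finset V} (hf : f ∈ F) (hg : g ∈ F) (hfg : f ≠ g) {v x : V}
    (hvf : v ∈ f) (hxf : x ∈ f) (hvg : v ∈ g) (hxg : x ∈ g) (hvx : v ≠ x) :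
    RunsAlong o v x f ↔ ¬ RunsAlong o v x g := by
  constructor
  · intro h h'
    exact hfg (ho.eq_of_runsAlong h h')
  · intro h
    rcases ho.runsAlong_or hF hf hvf hxf hvx with h1 | h1
    · exact h1
    · rcases ho.runsAlong_or hF hg hvg hxg hvx with h2 | h2
      · exact absurd h2 h
      · exact absurd (ho.eq_of_runsAlong h1 h2) hfg

lemma exists_next {v a : V} (he : ({v, a} : Finset V) ∈ edges F) : ∃ b, o v a b := by
  obtain ⟨f, g, hf, hg, hfg, hef, heg, -⟩ := hF.exists_two_faces he
  rw [pair_subset_iff] at hef heg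
  by_contra! H
  have h : ∀ f, ¬ RunsAlong o v a f := fun f ⟨b, hb, _⟩ => H b hb
  exact h f ((ho.runsAlong_iff_not hF hf hg hfg hef.1 hef.2 heg.1 heg.2
    (ne_of_pair_mem_edges he)).2 (h g))

lemma mem_edges_of {v a b : V} (h : o v a b) :
    ({v, a} : Finset V) ∈ edges F ∧ ({v, b} : Finset V) ∈ edges F :=
  ⟨pair_mem_edges (ho.face _ _ _ h) (by simp) (by simp) (ho.ne_of hF h).1,
    pair_mem_edges (ho.face _ _ _ h) (by simp) (by simp) (ho.ne_of hF h).2.1⟩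

/-- The rotation at a vertex is transitive on the neighbours. -/
lemma rotation_induction [Fintype V] {v : V} {Q : V → Prop} (hQ : ∀ a b, o v a b → Q a → Q b)
    {a : V} (ha : ({v, a} : Finset V) ∈ edges F) (hQa : Q a) {b : V}
    (hb : ({v, b} : Finset V) ∈ edges F) : Q b := by
  classical
  -- The rotation is an injective self-map of the finite set of neighbours satisfying `Q`, hence
  -- surjective on it; so `Q` also passes backwards.
  have hback : ∀ a b, o v a b → Q b → Q a := by
    intro a b hab hQb
    let T := (neighbors F v).filter Q
    have hT : ∀ x, x ∈ T ↔ ({v, x} : Finset V) ∈ edges F ∧ Q x := by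
      intro x; rw [Finset.mem_filter, mem_neighbors]
    choose! σ hσ using fun x (hx : ({v, x} : Finset V) ∈ edges F) => ho.exists_next hF hx
    have hmaps : ∀ x ∈ T, σ x ∈ T := by
      intro x hx
      rw [hT] at hx ⊢
      have := hσ x hx.1
      exact ⟨(ho.mem_edges_of hF this).2, hQ _ _ this hx.2⟩
    have hinj : Set.InjOn σ T := by
      intro x hx y hy hxy
      have h1 := hσ x ((hT x).1 hx).1
      have h2 := hσ y ((hT y).1 hy).1
      rw [hxy] at h1
      exact ho.coherent' h1 h2
    have hsurj := Finset.surjOn_of_injOn_of_card_le σ hmaps hinj le_rfl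
    obtain ⟨x, hx, hxb⟩ := hsurj (Finset.mem_coe.2 ((hT b).2 ⟨(ho.mem_edges_of hF hab).2, hQb⟩))
    have hx := (hT x).1 hx
    have h1 := hσ x hx.1
    rw [hxb] at h1
    rw [ho.coherent' hab h1]
    exact hx.2
  have hface : ∀ g ∈ F, v ∈ g → ∀ x ∈ g, x ≠ v → Q x → ∀ y ∈ g, y ≠ v → Q y := by
    intro g hg hvg x hx hxv hQx y hy hyv
    by_cases hxy : y = x
    · rwa [hxy]
    obtain ⟨z, hzv, hzx, rfl⟩ := exists_third hF hg hvg hx hxv.symm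
    simp only [Finset.mem_insert, Finset.mem_singleton, hyv, hxy, false_or] at hy
    subst hy
    rcases ho.exactly_one _ _ _ hg with h | h
    · exact hQ _ _ h.1 hQx
    · exact hback _ _ h.1 hQx
  obtain ⟨f, hf, hvf, -⟩ := mem_edges_iff.1 ha
  obtain ⟨g, hg, hvg, -⟩ := mem_edges_iff.1 hb
  rw [pair_subset_iff] at hvf hvg
  refine hF.star_induction (v := v) (P := fun g => ∀ x ∈ g, x ≠ v → Q x) ?_ hf hvf.1
    (hface f hf hvf.1 a hvf.2 (ne_of_pair_mem_edges ha).symm hQa) hg hvg.1 b hvg.2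
    (ne_of_pair_mem_edges hb).symm
  intro p hp q hq hvp hvq _ hpq hP
  obtain ⟨x, hxv, hx⟩ := exists_eq_pair_of_mem hpq (Finset.mem_inter.2 ⟨hvp, hvq⟩)
  have hxm : x ∈ p ∩ q := by rw [hx]; simp
  rw [Finset.mem_inter] at hxm
  exact hface q hq hvq x hxm.2 hxv.symm (hP x hxm.1 hxv.symm)

end IsOrientation

/-- The neighbours of `v` met by rotating around `v` from `s` on, before reaching `t`. -/
inductive Sweep (o : V → V → V → Prop) (v s t : V) : V → Prop
  | start : Sweep o v s t s
  | step {a b : V} : Sweep o v s t a → o v a b → b ≠ t → Sweep o v s t b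

namespace Sweep

variable {o : V → V → V → Prop} (ho : IsOrientation F o) (hF : IsTriangulatedSurface F)
  {v s t : V}

lemma not_end (hst : s ≠ t) : ¬ Sweep o v s t t := by
  intro h
  cases h with
  | start => exact hst rfl
  | step _ _ h => exact h rfl

include ho

lemma pred_iff {a b : V} (hab : o v a b) (hbs : b ≠ s) (hbt : b ≠ t) :
    Sweep o v s t a ↔ Sweep o v s t b := by
  refine ⟨fun h => h.step hab hbt, fun h => ?_⟩
  cases h with
  | start => exact absurd rfl hbs
  | step h1 h2 _ => rwa [ho.coherent' hab h2]

include hF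

/-- Otherwise the neighbours not swept would be closed under the rotation; starting from `t` they
would include `s`. -/
lemma not_pred_start [Fintype V] (hst : s ≠ t) (hs : ({v, s} : Finset V) ∈ edges F)
    (ht : ({v, t} : Finset V) ∈ edges F) {a : V} (ha : o v a s) : ¬ Sweep o v s t a := by
  intro hsw
  refine ho.rotation_induction hF (Q := fun x => ¬ Sweep o v s t x) ?_ ht (not_end hst) hs .start
  intro x y hxy hx hy
  cases hy with
  | start => exact hx (ho.coherent' ha hxy ▸ hsw)
  | step h1 h2 _ => exact hx (ho.coherent' h2 hxy ▸ h1)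

/-- Otherwise the sweep would never be stopped and would run on to `t` itself. -/
lemma pred_end [Fintype V] (hst : s ≠ t) (hs : ({v, s} : Finset V) ∈ edges F)
    (ht : ({v, t} : Finset V) ∈ edges F) {a : V} (ha : o v a t) : Sweep o v s t a := by
  by_contra hsw
  refine not_end hst (ho.rotation_induction hF (Q := Sweep o v s t) ?_ hs .start ht)
  intro x y hxy hx
  refine hx.step hxy ?_
  rintro rfl
  exact hsw (ho.coherent' hxy ha ▸ hx)

end Sweep

/-- The face `f` lies to the left of the path `t → v → s` at its vertex `v`. -/
def IsLeft (o : V → V → V → Prop) (v s t : V) (f : Finset V) : Prop :=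
  ∃ a b, o v a b ∧ f = {v, a, b} ∧ Sweep o v s t a

section

variable {o : V → V → V → Prop} (ho : IsOrientation F o) (hF : IsTriangulatedSurface F)
  {v s t : V}
include ho hF

lemma isLeft_iff {a b : V} (h : o v a b) : IsLeft o v s t {v, a, b} ↔ Sweep o v s t a := by
  refine ⟨?_, fun hs => ⟨a, b, h, rfl, hs⟩⟩
  rintro ⟨a', b', h', heq, hs⟩
  have h1 := ho.ne_of hF h
  have h2 := ho.ne_of hF h'
  have ha : a ∈ ({v, a', b'} : Finset V) := by rw [← heq]; simp
  simp only [Finset.mem_insert, Finset.mem_singleton, h1.1.symm, false_or] at ha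
  rcases ha with rfl | rfl
  · exact hs
  · have hb : b ∈ ({v, a', a} : Finset V) := by rw [← heq]; simp
    simp only [Finset.mem_insert, Finset.mem_singleton, h1.2.1.symm, h1.2.2.symm, false_or,
      or_false] at hb
    subst hb
    exact absurd h' (ho.not_swap h)

/-- The right-hand side does not depend on `f`, so the two faces at an edge off the path lie on the
same side. -/
lemma isLeft_iff_of_ne {x : V} {f : Finset V} (hf : f ∈ F) (hv : v ∈ f) (hx : x ∈ f) (hvx : v ≠ x)
    (hs : x ≠ s) (ht : x ≠ t) : IsLeft o v s t f ↔ Sweep o v s t x := by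
  rcases ho.runsAlong_or hF hf hv hx hvx with ⟨y, hy, rfl⟩ | ⟨y, hy, rfl⟩
  · exact isLeft_iff ho hF hy
  · have h := ho.cyclic _ _ _ hy
    rw [show ({x, v, y} : Finset V) = {v, y, x} by
      rw [Finset.insert_comm, Finset.pair_comm], isLeft_iff ho hF h]
    exact Sweep.pred_iff ho h hs ht

/-- At an edge of the path the side is decided by the direction in which the face runs along it.
With `isLeft_iff_end`, the two ends of a cycle edge then obey the same criterion. -/
lemma isLeft_iff_start [Fintype V] {f : Finset V} (hf : f ∈ F) (hv : v ∈ f) (hsf : s ∈ f)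
    (hst : s ≠ t) (hs : ({v, s} : Finset V) ∈ edges F) (ht : ({v, t} : Finset V) ∈ edges F) :
    IsLeft o v s t f ↔ RunsAlong o v s f := by
  have hvs := ne_of_pair_mem_edges hs
  rcases ho.runsAlong_or hF hf hv hsf hvs with h | h
  · refine iff_of_true ?_ h
    obtain ⟨y, hy, rfl⟩ := h
    exact ⟨s, y, hy, rfl, .start⟩
  · refine iff_of_false ?_ (ho.not_runsAlong_swap hF h)
    obtain ⟨y, hy, rfl⟩ := h
    have h := ho.cyclic _ _ _ hy
    rw [show ({s, v, y} : Finset V) = {v, y, s} by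
      rw [Finset.insert_comm, Finset.pair_comm], isLeft_iff ho hF h]
    exact Sweep.not_pred_start ho hF hst hs ht h

lemma isLeft_iff_end [Fintype V] {f : Finset V} (hf : f ∈ F) (hv : v ∈ f) (htf : t ∈ f)
    (hst : s ≠ t) (hs : ({v, s} : Finset V) ∈ edges F) (ht : ({v, t} : Finset V) ∈ edges F) :
    IsLeft o v s t f ↔ RunsAlong o t v f := by
  have hvt := ne_of_pair_mem_edges ht
  rcases ho.runsAlong_or hF hf hv htf hvt with h | h
  · refine iff_of_false ?_ (ho.not_runsAlong_swap hF h)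
    obtain ⟨y, hy, rfl⟩ := h
    rw [isLeft_iff ho hF hy]
    exact Sweep.not_end hst
  · refine iff_of_true ?_ h
    obtain ⟨y, hy, rfl⟩ := h
    have h := ho.cyclic _ _ _ hy
    rw [show ({t, v, y} : Finset V) = {v, y, t} by
      rw [Finset.insert_comm, Finset.pair_comm], isLeft_iff ho hF h]
    exact Sweep.pred_end ho hF hst hs ht h

/-- An oriented surface cut along a cycle has two boundary cycles. -/
theorem exists_isCutSide [Fintype V] {k : ℕ} {c : ZMod k → V} (hc : IsCycle F c) :
    ∃ B : Finset (V × Finset V), IsCutSide F c B := by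
  classical
  -- `B` collects the corners to the left of the directed cycle.
  let B : Finset (V × Finset V) := (Finset.univ ×ˢ F).filter fun p =>
    p.1 ∈ p.2 ∧ ∃ i, p.1 = c i ∧ IsLeft o (c i) (c (i + 1)) (c (i - 1)) p.2
  have hmem : ∀ i f, f ∈ F → c i ∈ f →
      ((c i, f) ∈ B ↔ IsLeft o (c i) (c (i + 1)) (c (i - 1)) f) := by
    intro i f hf hif
    simp only [B, Finset.mem_filter, Finset.mem_product, Finset.mem_univ, true_and, hf, hif]
    constructor
    · rintro ⟨j, hj, h⟩
      rwa [hc.injective hj]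
    · intro h
      exact ⟨i, rfl, h⟩
  -- Equality would give `2 = 0` in `ZMod k`, which length at least 3 excludes.
  have hst : ∀ i, c (i + 1) ≠ c (i - 1) := by
    intro i h
    have h1 := hc.injective h
    have h2 : ((2 : ℕ) : ZMod k) = 0 := by
      push_cast
      linear_combination h1
    rw [ZMod.natCast_eq_zero_iff] at h2
    have := Nat.le_of_dvd (by norm_num) h2
    have := hc.three_le
    omega
  have hsucc : ∀ i, ({c i, c (i + 1)} : Finset V) ∈ edges F := hc.edge
  have hpred : ∀ i, ({c i, c (i - 1)} : Finset V) ∈ edges F := by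
    intro i
    have := hc.edge (i - 1)
    rwa [sub_add_cancel, Finset.pair_comm] at this
  have hedge : ∀ j f, f ∈ F → c j ∈ f → c (j + 1) ∈ f → ∀ v ∈ ({c j, c (j + 1)} : Finset V),
      ((v, f) ∈ B ↔ RunsAlong o (c j) (c (j + 1)) f) := by
    intro j f hf h1 h2 v hv
    simp only [Finset.mem_insert, Finset.mem_singleton] at hv
    rcases hv with rfl | rfl
    · rw [hmem j f hf h1]
      exact isLeft_iff_start ho hF hf h1 h2 (hst j) (hsucc j) (hpred j)
    · rw [hmem (j + 1) f hf h2, isLeft_iff_end ho hF hf h2 (by rwa [add_sub_cancel_right])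
        (hst (j + 1)) (hsucc (j + 1)) (hpred (j + 1)), add_sub_cancel_right]
  refine ⟨B, ?_, ?_, ?_, ?_⟩
  · intro v f h
    simp only [B, Finset.mem_filter, Finset.mem_product, Finset.mem_univ, true_and] at h
    obtain ⟨hf, hv, i, hi, -⟩ := h
    exact ⟨hf, hv, i, hi.symm⟩
  · intro f hf g hg e he hef heg hec v hv
    by_cases hvc : v ∈ Set.range c
    · obtain ⟨i, rfl⟩ := hvc
      obtain ⟨x, hvx, rfl⟩ := exists_eq_pair_of_mem (card_of_mem_edges he) hv
      rw [pair_subset_iff] at hef heg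
      have hs : x ≠ c (i + 1) := by
        rintro rfl
        exact hec ⟨i, rfl⟩
      have ht : x ≠ c (i - 1) := by
        rintro rfl
        exact hec ⟨i - 1, by rw [sub_add_cancel, Finset.pair_comm]⟩
      rw [hmem i f hf hef.1, hmem i g hg heg.1, isLeft_iff_of_ne ho hF hf hef.1 hef.2 hvx hs ht,
        isLeft_iff_of_ne ho hF hg heg.1 heg.2 hvx hs ht]
    · have hB : ∀ f, (v, f) ∉ B := by
        intro f h
        simp only [B, Finset.mem_filter] at h
        obtain ⟨-, -, i, hi, -⟩ := h
        exact hvc ⟨i, hi.symm⟩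
      exact iff_of_false (hB f) (hB g)
  · rintro f hf g hg hfg e ⟨j, rfl⟩ hef heg v hv
    rw [pair_subset_iff] at hef heg
    rw [hedge j f hf hef.1 hef.2 v hv, hedge j g hg heg.1 heg.2 v hv]
    exact ho.runsAlong_iff_not hF hf hg hfg hef.1 hef.2 heg.1 heg.2
      (ne_of_pair_mem_edges (hsucc j))
  · rintro f hf e ⟨j, rfl⟩ hef u hu v hv
    rw [pair_subset_iff] at hef
    rw [hedge j f hf hef.1 hef.2 u hu, hedge j f hf hef.1 hef.2 v hv]

end

end Surface
section Cover

variable {V : Type*} [DecidableEq V] {F : Finset (Finset V)}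

/-! ### The cover -/

/-- The layer shift at a corner. -/
def shift (B : Finset (V × Finset V)) (d : ℕ) (v : V) (f : Finset V) : ZMod d :=
  if (v, f) ∈ B then 1 else 0

/-- The copy of the face `f` in the `i`-th layer. -/
def liftFace (B : Finset (V × Finset V)) {d : ℕ} (f : Finset V) (i : ZMod d) :
    Finset (V × ZMod d) :=
  f.image fun v => (v, i + shift B d v f)

variable {B : Finset (V × Finset V)} {d : ℕ}

lemma mem_coverFaces [NeZero d] {x : Finset (V × ZMod d)} :
    x ∈ coverFaces F B d ↔ ∃ f ∈ F, ∃ i, liftFace B f i = x := by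
  simp only [coverFaces, Finset.mem_image, Finset.mem_product, Finset.mem_univ, and_true,
    Prod.exists]
  exact ⟨fun ⟨f, i, hf, h⟩ => ⟨f, hf, i, h⟩, fun ⟨f, hf, i, h⟩ => ⟨f, i, hf, h⟩⟩

lemma liftFace_mem [NeZero d] {f : Finset V} (hf : f ∈ F) (i : ZMod d) :
    liftFace B f i ∈ coverFaces F B d := mem_coverFaces.2 ⟨f, hf, i, rfl⟩

lemma mem_liftFace {f : Finset V} {i j : ZMod d} {v : V} :
    (v, j) ∈ liftFace B f i ↔ v ∈ f ∧ i + shift B d v f = j := by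
  simp only [liftFace, Finset.mem_image, Prod.mk.injEq]
  constructor
  · rintro ⟨w, hw, rfl, h⟩
    exact ⟨hw, h⟩
  · rintro ⟨hv, h⟩
    exact ⟨v, hv, rfl, h⟩

lemma image_fst_liftFace (f : Finset V) (i : ZMod d) :
    (liftFace B f i).image Prod.fst = f := by
  simp [liftFace, Finset.image_image, Function.comp_def]

lemma card_liftFace (f : Finset V) (i : ZMod d) : (liftFace B f i).card = f.card :=
  Finset.card_image_of_injective _ fun _ _ h => congrArg Prod.fst h

lemma liftFace_eq_iff {f g : Finset V} {i j : ZMod d} (hf : f.Nonempty) :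
    liftFace B f i = liftFace B g j ↔ f = g ∧ i = j := by
  refine ⟨fun h => ?_, fun h => by rw [h.1, h.2]⟩
  have hfg : f = g := by
    rw [← image_fst_liftFace (B := B) f i, h, image_fst_liftFace]
  subst hfg
  obtain ⟨v, hv⟩ := hf
  have h1 : (v, i + shift B d v f) ∈ liftFace B f j := h ▸ mem_liftFace.2 ⟨hv, rfl⟩
  exact ⟨rfl, (add_right_cancel (mem_liftFace.1 h1).2).symm⟩

lemma inter_eq_pair {α : Type*} [DecidableEq α] {f g : Finset α} (hf : f.card = 3)
    (hg : g.card = 3) (hfg : f ≠ g) {u v : α} (huv : u ≠ v) (huf : u ∈ f) (hvf : v ∈ f)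
    (hug : u ∈ g) (hvg : v ∈ g) : f ∩ g = {u, v} := by
  symm
  apply Finset.eq_of_subset_of_card_le
  · rw [pair_subset_iff]
    exact ⟨Finset.mem_inter.2 ⟨huf, hug⟩, Finset.mem_inter.2 ⟨hvf, hvg⟩⟩
  · rw [Finset.card_pair huv]
    by_contra hlt
    have h1 : f ∩ g = f := Finset.eq_of_subset_of_card_le Finset.inter_subset_left (by omega)
    have h2 : f ∩ g = g := Finset.eq_of_subset_of_card_le Finset.inter_subset_right (by omega)
    exact hfg (h1.symm.trans h2)

lemma shift_congr {v w : V} {f g : Finset V} (h : (v, f) ∈ B ↔ (w, g) ∈ B) :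
    shift B d v f = shift B d w g := by simp only [shift, h]

namespace IsCutSide

variable {k : ℕ} {c : ZMod k → V} (hB : IsCutSide F c B)
include hB

/-- The relative shift of the ends of an edge is the same in both faces there: on the cycle it is
zero in each face, and off the cycle the shifts themselves agree. -/
lemma shift_add {f g : Finset V} (hf : f ∈ F) (hg : g ∈ F) {u v : V} (huv : u ≠ v) (huf : u ∈ f)
    (hvf : v ∈ f) (hug : u ∈ g) (hvg : v ∈ g) :
    shift B d v f + shift B d u g = shift B d v g + shift B d u f := by
  by_cases he : ({u, v} : Finset V) ∈ cycleEdges c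
  · have h1 := hB.boundary f hf _ he (pair_subset_iff.2 ⟨huf, hvf⟩) u (by simp) v (by simp)
    have h2 := hB.boundary g hg _ he (pair_subset_iff.2 ⟨hug, hvg⟩) u (by simp) v (by simp)
    rw [shift_congr h1, shift_congr h2, add_comm]
  · have h1 := fun w hw => hB.glued f hf g hg _ (pair_mem_edges hf huf hvf huv)
      (pair_subset_iff.2 ⟨huf, hvf⟩) (pair_subset_iff.2 ⟨hug, hvg⟩) he w hw
    rw [shift_congr (h1 u (by simp)), shift_congr (h1 v (by simp))]

/-- Lifts of adjacent faces that share one end of a lifted edge share the whole edge. This makes the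
cover locally a copy of the base. -/
lemma mem_liftFace_of_common {f g : Finset V} (hf : f ∈ F) (hg : g ∈ F) {u v : V} {a b i j : ZMod d}
    (huv : u ≠ v) (huf : (u, a) ∈ liftFace B f i) (hvf : (v, b) ∈ liftFace B f i)
    (hug : (u, a) ∈ liftFace B g j) (hvg : v ∈ g) : (v, b) ∈ liftFace B g j := by
  rw [mem_liftFace] at *
  refine ⟨hvg, ?_⟩
  have := hB.shift_add (d := d) hf hg huv huf.1 hvf.1 hug.1 hvg
  linear_combination hug.2 - huf.2 + hvf.2 - this

end IsCutSide

section

variable [NeZero d]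

lemma exists_edge_lift {e : Finset (V × ZMod d)} (he : e ∈ edges (coverFaces F B d)) :
    ∃ f ∈ F, ∃ i : ZMod d, ∃ u v a b, u ≠ v ∧ e = {(u, a), (v, b)} ∧ e ⊆ liftFace B f i ∧
      (u, a) ∈ liftFace B f i ∧ (v, b) ∈ liftFace B f i := by
  obtain ⟨x, hx, hex, hcard⟩ := mem_edges_iff.1 he
  obtain ⟨f, hf, i, rfl⟩ := mem_coverFaces.1 hx
  obtain ⟨⟨u, a⟩, ⟨v, b⟩, hne, rfl⟩ := Finset.card_eq_two.1 hcard
  have h := pair_subset_iff.1 hex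
  refine ⟨f, hf, i, u, v, a, b, ?_, rfl, hex, h⟩
  rintro rfl
  exact hne (by rw [← (mem_liftFace.1 h.1).2, ← (mem_liftFace.1 h.2).2])

lemma mem_liftFace_sub {v : V} {f : Finset V} (hv : v ∈ f) (j : ZMod d) :
    (v, j) ∈ liftFace B f (j - shift B d v f) := mem_liftFace.2 ⟨hv, sub_add_cancel _ _⟩

lemma eq_sub_of_mem {v : V} {f : Finset V} {i j : ZMod d} (h : (v, j) ∈ liftFace B f i) :
    i = j - shift B d v f := eq_sub_of_add_eq (mem_liftFace.1 h).2

variable (hF : IsTriangulatedSurface F)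
include hF

lemma card_of_mem_coverFaces {x : Finset (V × ZMod d)} (hx : x ∈ coverFaces F B d) :
    x.card = 3 := by
  obtain ⟨f, hf, i, rfl⟩ := mem_coverFaces.1 hx
  rw [card_liftFace, hF.card_three f hf]

lemma nonempty_of_mem {f : Finset V} (hf : f ∈ F) : f.Nonempty := by
  rw [← Finset.card_pos, hF.card_three f hf]
  norm_num

/-- Each face at `v` has exactly one lift through `(v, j)`. -/
lemma isOfType3_cover {q : ℕ} (hq : IsOfType3 F q) : IsOfType3 (coverFaces F B d) q := by
  rintro ⟨v, j⟩
  rw [← hq v]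
  symm
  apply Finset.card_bij fun f _ => liftFace B f (j - shift B d v f)
  · intro f hf
    rw [Finset.mem_filter] at hf ⊢
    exact ⟨liftFace_mem hf.1 _, mem_liftFace_sub hf.2 j⟩
  · intro f hf g _ h
    exact ((liftFace_eq_iff (nonempty_of_mem hF (Finset.mem_filter.1 hf).1)).1 h).1
  · intro x hx
    rw [Finset.mem_filter] at hx
    obtain ⟨f, hf, i, rfl⟩ := mem_coverFaces.1 hx.1
    exact ⟨f, Finset.mem_filter.2 ⟨hf, (mem_liftFace.1 hx.2).1⟩, by rw [← eq_sub_of_mem hx.2]⟩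

lemma isOrientable_cover (ho : IsOrientable F) : IsOrientable (coverFaces F B d) := by
  obtain ⟨o, ho⟩ := ho
  have hproj : ∀ x ∈ coverFaces F B d, x.image Prod.fst ∈ F := by
    intro x hx
    obtain ⟨f, hf, i, rfl⟩ := mem_coverFaces.1 hx
    rwa [image_fst_liftFace]
  refine ⟨fun x y z => o x.1 y.1 z.1 ∧ {x, y, z} ∈ coverFaces F B d, ?_, ?_, ?_, ?_⟩
  · exact fun x y z h => h.2
  · rintro x y z ⟨h1, h2⟩
    refine ⟨ho.cyclic _ _ _ h1, ?_⟩
    rwa [Finset.pair_comm, Finset.insert_comm]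
  · intro x y z h
    have h' : ({x, z, y} : Finset (V × ZMod d)) ∈ coverFaces F B d := by
      rwa [Finset.pair_comm]
    have h1 := hproj _ h
    simp only [Finset.image_insert, Finset.image_singleton] at h1
    simpa only [h, h', and_true] using ho.exactly_one _ _ _ h1
  · rintro x y z z' ⟨h1, h2⟩ ⟨h1', h2'⟩
    have hz := ho.coherent _ _ _ _ h1 h1'
    -- A lifted face is determined by its projection and its vertex `x`; this forces `z = z'` once
    -- they project to the same vertex.
    have key : ∀ w : V × ZMod d, {x, y, w} ∈ coverFaces F B d →
        ({x, y, w} : Finset (V × ZMod d)) = liftFace B {x.1, y.1, w.1}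
          (x.2 - shift B d x.1 {x.1, y.1, w.1}) := by
      intro w hw
      obtain ⟨f, hf, i, hfi⟩ := mem_coverFaces.1 hw
      have hf' : f = {x.1, y.1, w.1} := by
        rw [← image_fst_liftFace (B := B) f i, hfi]
        simp
      have hx : (x.1, x.2) ∈ liftFace B f i := by rw [hfi]; simp
      rw [← hf', ← eq_sub_of_mem hx, hfi]
    have h3 := key z h2
    have h3' := key z' h2'
    rw [← hz, ← h3] at h3'
    have h4 : z ∈ ({x, y, z'} : Finset (V × ZMod d)) := by rw [h3']; simp
    have h5 := ho.ne_of hF h1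
    simp only [Finset.mem_insert, Finset.mem_singleton] at h4
    rcases h4 with rfl | rfl | h4
    · exact absurd rfl h5.2.1
    · exact absurd rfl h5.2.2
    · exact h4

variable {k : ℕ} {c : ZMod k → V} (hB : IsCutSide F c B)
include hB

lemma two_faces_cover (e : Finset (V × ZMod d)) (he : e ∈ edges (coverFaces F B d)) :
    ((coverFaces F B d).filter fun x => e ⊆ x).card = 2 := by
  obtain ⟨f, hf, i, u, v, a, b, huv, rfl, -, hu, hv⟩ := exists_edge_lift he
  have huf := (mem_liftFace.1 hu).1
  have hvf := (mem_liftFace.1 hv).1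
  obtain ⟨g, hg, hgf, heg, H⟩ := hF.exists_other_face (pair_mem_edges hf huf hvf huv) hf
    (pair_subset_iff.2 ⟨huf, hvf⟩)
  rw [pair_subset_iff] at heg
  have hmem : ∀ h ∈ F, ∀ l : ZMod d, ({(u, a), (v, b)} ⊆ liftFace B h l ↔
      (u ∈ h ∧ v ∈ h) ∧ l = a - shift B d u h) := by
    intro h hh l
    rw [pair_subset_iff]
    constructor
    · rintro ⟨h1, h2⟩
      exact ⟨⟨(mem_liftFace.1 h1).1, (mem_liftFace.1 h2).1⟩, eq_sub_of_mem h1⟩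
    · rintro ⟨⟨h1, h2⟩, rfl⟩
      have h3 := mem_liftFace_sub (B := B) h1 a
      exact ⟨h3, hB.mem_liftFace_of_common hf hh huv hu hv h3 h2⟩
  rw [Finset.card_eq_two]
  refine ⟨liftFace B f (a - shift B d u f), liftFace B g (a - shift B d u g), ?_, ?_⟩
  · intro h
    exact hgf ((liftFace_eq_iff (nonempty_of_mem hF hf)).1 h).1.symm
  · ext x
    simp only [Finset.mem_filter, Finset.mem_insert, Finset.mem_singleton]
    constructor
    · rintro ⟨hx, hex⟩
      obtain ⟨h, hh, l, rfl⟩ := mem_coverFaces.1 hx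
      obtain ⟨h1, rfl⟩ := (hmem h hh l).1 hex
      rcases H h hh (pair_subset_iff.2 h1) with rfl | rfl
      · exact Or.inl rfl
      · exact Or.inr rfl
    · rintro (rfl | rfl)
      · exact ⟨liftFace_mem hf _, (hmem f hf _).2 ⟨⟨huf, hvf⟩, rfl⟩⟩
      · exact ⟨liftFace_mem hg _, (hmem g hg _).2 ⟨heg, rfl⟩⟩

/-- Adjacent faces at `v` have adjacent lifts through `(v, j)`, so connectedness of the star lifts.
-/
lemma face_cycle_cover (v : V) (j : ZMod d) :
    ((dualGraph (coverFaces F B d)).induce {x | (v, j) ∈ x.1}).Connected := by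
  obtain ⟨f0, hf0, hv0⟩ := hF.exists_face v
  refine connected_of_induction
    ⟨⟨liftFace B f0 (j - shift B d v f0), liftFace_mem hf0 _⟩, mem_liftFace_sub hv0 j⟩
    fun Q hQ hQ0 => ?_
  rintro ⟨⟨x, hx⟩, hvx⟩
  obtain ⟨g, hg, i, rfl⟩ := mem_coverFaces.1 hx
  have hvx' : (v, j) ∈ liftFace B g i := hvx
  have key := hF.star_induction (v := v)
    (P := fun f => ∀ (hf : f ∈ F) (hv : v ∈ f),
      Q ⟨⟨liftFace B f (j - shift B d v f), liftFace_mem hf _⟩, mem_liftFace_sub hv j⟩)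
    ?_ hf0 hv0 (fun _ _ => hQ0) hg (mem_liftFace.1 hvx').1 hg (mem_liftFace.1 hvx').1
  · obtain rfl := eq_sub_of_mem hvx'
    exact key
  · intro f hf g hg hvf hvg hfg hcard hP hg' hvg'
    refine hQ _ _ ?_ (hP hf hvf)
    obtain ⟨w, hvw, hw⟩ := exists_eq_pair_of_mem hcard (Finset.mem_inter.2 ⟨hvf, hvg⟩)
    have hwm : w ∈ f ∩ g := by rw [hw]; simp
    rw [Finset.mem_inter] at hwm
    have hne : liftFace B f (j - shift B d v f) ≠ liftFace B g (j - shift B d v g) :=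
      fun h => hfg ((liftFace_eq_iff (nonempty_of_mem hF hf)).1 h).1
    have h1 := mem_liftFace_sub (B := B) hvf j
    have h2 := mem_liftFace_sub (B := B) hvg j
    have h3 : (w, j - shift B d v f + shift B d w f) ∈ liftFace B f (j - shift B d v f) :=
      mem_liftFace.2 ⟨hwm.1, rfl⟩
    have h4 := hB.mem_liftFace_of_common hf hg hvw h1 h3 h2 hwm.2
    have hne' : (v, j) ≠ (w, j - shift B d v f + shift B d w f) :=
      fun h => hvw (congrArg Prod.fst h)
    refine ⟨fun h => hne (congrArg Subtype.val h), ?_⟩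
    change (liftFace B f (j - shift B d v f) ∩ liftFace B g (j - shift B d v g)).card = 2
    rw [inter_eq_pair (card_of_mem_coverFaces hF (liftFace_mem hf _))
      (card_of_mem_coverFaces hF (liftFace_mem hg _)) hne hne' h1 h3 h2 h4, Finset.card_pair hne']

variable (hc : IsCycle F c)
include hc

/-- The lift of the cycle to a level of the cover is a cycle. -/
lemma isCycle_lift (j : ZMod d) : IsCycle (coverFaces F B d) fun i => (c i, j) := by
  refine ⟨hc.three_le, fun i i' h => hc.injective (congrArg Prod.fst h), fun i => ?_⟩
  obtain ⟨f, hf, hef, -⟩ := mem_edges_iff.1 (hc.edge i)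
  have hb := hB.boundary f hf _ ⟨i, rfl⟩ hef (c i) (by simp) (c (i + 1)) (by simp)
  rw [pair_subset_iff] at hef
  have h1 := mem_liftFace_sub (B := B) hef.1 j
  have h2 := mem_liftFace_sub (B := B) hef.2 j
  rw [← shift_congr hb] at h2
  exact pair_mem_edges (liftFace_mem hf _) h1 h2
    fun h => ne_of_pair_mem_edges (hc.edge i) (congrArg Prod.fst h)

variable (hns : IsNonseparating F c)
include hns

/-- The cover cut along one lift of the cycle is a chain of copies of the cut surface. -/
lemma isNonseparating_lift :
    IsNonseparating (coverFaces F B d) fun i => (c i, (0 : ZMod d)) := by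
  obtain ⟨f0, hf0⟩ := hF.exists_mem
  refine connected_of_induction ⟨liftFace B f0 0, liftFace_mem hf0 _⟩ fun Q hQ hQ0 => ?_
  have hadj : ∀ f g (i j : ZMod d) u v a b, ∀ hf : f ∈ F, ∀ hg : g ∈ F, f ≠ g → u ≠ v →
      (u, a) ∈ liftFace B f i → (v, b) ∈ liftFace B f i → (u, a) ∈ liftFace B g j →
      (v, b) ∈ liftFace B g j → {(u, a), (v, b)} ∉ cycleEdges (fun i => (c i, (0 : ZMod d))) →
      Q ⟨liftFace B f i, liftFace_mem hf i⟩ → Q ⟨liftFace B g j, liftFace_mem hg j⟩ := by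
    intro f g i j u v a b hf hg hfg huv h1 h2 h3 h4 hnot hQf
    have hne : liftFace B f i ≠ liftFace B g j :=
      fun h => hfg ((liftFace_eq_iff (nonempty_of_mem hF hf)).1 h).1
    have hne' : (u, a) ≠ (v, b) := fun h => huv (congrArg Prod.fst h)
    have hinter := inter_eq_pair (card_of_mem_coverFaces hF (liftFace_mem hf i))
      (card_of_mem_coverFaces hF (liftFace_mem hg j)) hne hne' h1 h2 h3 h4
    refine hQ _ _ ⟨⟨fun h => hne (congrArg Subtype.val h), ?_⟩, ?_⟩ hQf
    · change (liftFace B f i ∩ liftFace B g j).card = 2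
      rw [hinter, Finset.card_pair hne']
    · change liftFace B f i ∩ liftFace B g j ∉ _
      rwa [hinter]
  -- Within a layer the faces are glued as in the cut base, which is connected because the cycle is
  -- nonseparating.
  have hlayer : ∀ (i : ZMod d) f g, ∀ hf : f ∈ F, ∀ hg : g ∈ F,
      Q ⟨liftFace B f i, liftFace_mem hf i⟩ → Q ⟨liftFace B g i, liftFace_mem hg i⟩ := by
    intro i f g hf hg hQf
    refine connected_induction hns (P := fun f => Q ⟨liftFace B f.1 i, liftFace_mem f.2 i⟩)
      ?_ (a := ⟨f, hf⟩) hQf ⟨g, hg⟩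
    rintro ⟨p, hp⟩ ⟨q, hq⟩ ⟨⟨hpq, hcard⟩, hnot⟩ hQp
    change (p ∩ q).card = 2 at hcard
    change p ∩ q ∉ cycleEdges c at hnot
    obtain ⟨u, v, huv, hinter⟩ := Finset.card_eq_two.1 hcard
    have hu : u ∈ p ∩ q := by rw [hinter]; simp
    have hv : v ∈ p ∩ q := by rw [hinter]; simp
    have hglue := hB.glued p hp q hq (p ∩ q)
      (mem_edges_iff.2 ⟨p, hp, Finset.inter_subset_left, hcard⟩) Finset.inter_subset_left
      Finset.inter_subset_right hnot
    have hu' := shift_congr (d := d) (hglue u hu)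
    have hv' := shift_congr (d := d) (hglue v hv)
    rw [Finset.mem_inter] at hu hv
    refine hadj p q i i u v (i + shift B d u p) (i + shift B d v p) hp hq
      (fun h => hpq (Subtype.ext h)) huv (mem_liftFace.2 ⟨hu.1, rfl⟩) (mem_liftFace.2 ⟨hv.1, rfl⟩)
      (mem_liftFace.2 ⟨hu.2, by rw [hu']⟩) (mem_liftFace.2 ⟨hv.2, by rw [hv']⟩) ?_ hQp
    rintro ⟨l, hl⟩
    apply hnot
    refine ⟨l, ?_⟩
    have := congrArg (Finset.image Prod.fst) hl
    simpa [hinter] using this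
  -- Crossing the cycle from its `B` side leads from layer `i` to layer `i + 1` through the lift at
  -- level `i + 1`; only the lift at level 0 has been cut.
  have hstep : ∀ i : ZMod d, i + 1 ≠ 0 →
      (∀ f, ∀ hf : f ∈ F, Q ⟨liftFace B f i, liftFace_mem hf i⟩) →
      ∀ f, ∀ hf : f ∈ F, Q ⟨liftFace B f (i + 1), liftFace_mem hf (i + 1)⟩ := by
    intro i hi hQi f hf
    have hmem : ∃ f g, ∃ _ : f ∈ F, ∃ _ : g ∈ F, f ≠ g ∧ {c 0, c (0 + 1)} ⊆ f ∧
        {c 0, c (0 + 1)} ⊆ g ∧ (c 0, f) ∈ B ∧ (c 0, g) ∉ B := by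
      obtain ⟨f, g, hf, hg, hfg, hef, heg, -⟩ := hF.exists_two_faces (hc.edge 0)
      have h := hB.cut f hf g hg hfg _ ⟨0, rfl⟩ hef heg (c 0) (by simp)
      by_cases hb : (c 0, f) ∈ B
      · exact ⟨f, g, hf, hg, hfg, hef, heg, hb, h.1 hb⟩
      · exact ⟨g, f, hg, hf, hfg.symm, heg, hef, not_not.1 fun hb' => hb (h.2 hb'), hb⟩
    obtain ⟨p, q, hp, hq, hpq, hep, heq, hBp, hBq⟩ := hmem
    have hp1 := hB.boundary p hp _ ⟨0, rfl⟩ hep (c 0) (by simp) (c (0 + 1)) (by simp)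
    have hq1 := hB.boundary q hq _ ⟨0, rfl⟩ heq (c 0) (by simp) (c (0 + 1)) (by simp)
    rw [pair_subset_iff] at hep heq
    refine hlayer (i + 1) q f hq hf (hadj p q i (i + 1) (c 0) (c (0 + 1)) (i + 1) (i + 1) hp hq hpq
      (ne_of_pair_mem_edges (hc.edge 0)) (mem_liftFace.2 ⟨hep.1, ?_⟩) (mem_liftFace.2 ⟨hep.2, ?_⟩)
      (mem_liftFace.2 ⟨heq.1, ?_⟩) (mem_liftFace.2 ⟨heq.2, ?_⟩) ?_ (hQi p hp))
    · simp [shift, hBp]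
    · rw [shift, if_pos (hp1.1 hBp)]
    · simp [shift, hBq]
    · rw [shift, if_neg fun h => hBq (hq1.2 h), add_zero]
    · rintro ⟨l, hl⟩
      have : (c 0, i + 1) ∈ ({(c l, 0), (c (l + 1), 0)} : Finset (V × ZMod d)) := by
        rw [← show ({(c 0, i + 1), (c (0 + 1), i + 1)} : Finset (V × ZMod d)) = _ from hl]
        simp
      simp [hi] at this
  have hall : ∀ n < d, ∀ f, ∀ hf : f ∈ F,
      Q ⟨liftFace B f (n : ZMod d), liftFace_mem hf _⟩ := by
    intro n
    induction n with
    | zero =>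
      intro _ f hf
      have := hlayer 0 f0 f hf0 hf hQ0
      simpa using this
    | succ n ih =>
      intro hn f hf
      have hne : (n : ZMod d) + 1 ≠ 0 := by
        intro h
        have h' : ((n + 1 : ℕ) : ZMod d) = 0 := by push_cast; exact h
        rw [ZMod.natCast_eq_zero_iff] at h'
        have := Nat.le_of_dvd (by omega) h'
        omega
      have := hstep n hne (ih (by omega)) f hf
      simpa using this
  rintro ⟨x, hx⟩
  obtain ⟨f, hf, i, rfl⟩ := mem_coverFaces.1 hx
  have := hall i.val (ZMod.val_lt i) f hf
  simpa using this

omit hF hB hc hns [NeZero d] in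
lemma cutDualGraph_le (F : Finset (Finset V)) (c : ZMod k → V) :
    cutDualGraph F c ≤ dualGraph F := fun _ _ h => h.1

/-- The cover along a nonseparating cycle is a connected closed surface. -/
theorem isTriangulatedSurface_cover : IsTriangulatedSurface (coverFaces F B d) :=
  ⟨fun _ hx => card_of_mem_coverFaces hF hx, two_faces_cover hF hB,
    fun v => face_cycle_cover hF hB v.1 v.2,
    SimpleGraph.Connected.mono (cutDualGraph_le _ _) (isNonseparating_lift (d := d) hF hB hc hns)⟩

end

end Cover
/-! ### The map `mapN1` -/

section Spread

variable {V : Type*} [DecidableEq V]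

/-- The faces in `S` or adjacent to a face in `S`. -/
def spread (G S : Finset (Finset V)) : Finset (Finset V) :=
  G.filter fun f => f ∈ S ∨ ∃ g ∈ S, (g ∩ f).card = 2

/-- Turns connectedness into a finite search from `f0` that can be evaluated. -/
lemma of_mem_spread {G : Finset (Finset V)} {f0 : Finset V} (hf0 : f0 ∈ G) {Q : Finset V → Prop}
    (hQ : ∀ f ∈ G, ∀ g ∈ G, f ≠ g → (f ∩ g).card = 2 → Q f → Q g) (h0 : Q f0) (n : ℕ) :
    ∀ f ∈ (spread G)^[n] {f0}, f ∈ G ∧ Q f := by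
  induction n with
  | zero =>
    intro f hf
    rw [Function.iterate_zero, id, Finset.mem_singleton] at hf
    exact hf ▸ ⟨hf0, h0⟩
  | succ n ih =>
    intro f hf
    rw [Function.iterate_succ_apply', spread, Finset.mem_filter] at hf
    obtain ⟨hf, h | ⟨g, hg, hgf⟩⟩ := hf
    · exact ih f h
    · refine ⟨hf, ?_⟩
      by_cases hne : g = f
      · exact hne ▸ (ih g hg).2
      · exact hQ g (ih g hg).1 f hf hne hgf (ih g hg).2

lemma connected_of_spread {F : Finset (Finset V)} {f0 : Finset V} (hf0 : f0 ∈ F) (n : ℕ)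
    (h : F ⊆ (spread F)^[n] {f0}) : (dualGraph F).Connected := by
  refine connected_of_induction ⟨f0, hf0⟩ fun Q hQ hQ0 => ?_
  rintro ⟨f, hf⟩
  exact (of_mem_spread hf0 (Q := fun f => ∀ hf : f ∈ F, Q ⟨f, hf⟩)
    (fun f hf g hg hfg hcard hQf hg' => hQ ⟨f, hf⟩ ⟨g, hg⟩
      ⟨fun h => hfg (congrArg Subtype.val h), hcard⟩ (hQf hf)) (fun _ => hQ0) n f (h hf)).2 hf

lemma star_connected_of_spread {F : Finset (Finset V)} {v : V} {f0 : Finset V}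
    (hf0 : f0 ∈ F.filter (v ∈ ·)) (n : ℕ)
    (h : F.filter (v ∈ ·) ⊆ (spread (F.filter (v ∈ ·)))^[n] {f0}) :
    ((dualGraph F).induce {f | v ∈ f.1}).Connected := by
  have hm := Finset.mem_filter.1 hf0
  refine connected_of_induction ⟨⟨f0, hm.1⟩, hm.2⟩ fun Q hQ hQ0 => ?_
  rintro ⟨⟨f, hf⟩, hv⟩
  refine (of_mem_spread hf0 (Q := fun f => ∀ (hf : f ∈ F) (hv : v ∈ f), Q ⟨⟨f, hf⟩, hv⟩) ?_
    (fun _ _ => hQ0) n f (h (Finset.mem_filter.2 ⟨hf, hv⟩))).2 hf hv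
  intro f hf g hg hfg hcard hQf hg' hvg
  have hf' := Finset.mem_filter.1 hf
  exact hQ ⟨⟨f, hf'.1⟩, hf'.2⟩ ⟨⟨g, hg'⟩, hvg⟩
    ⟨fun h => hfg (congrArg Subtype.val h), hcard⟩ (hQf hf'.1 hf'.2)

end Spread

/-- The faces of `mapN1` with their orientations. -/
def orientedFacesN1 : List (Fin 12 × Fin 12 × Fin 12) :=
  [(0, 1, 2), (1, 0, 3), (0, 2, 4), (0, 5, 3), (0, 4, 6), (0, 7, 5), (0, 6, 7), (2, 1, 5),
   (6, 1, 3), (8, 5, 1), (6, 9, 1), (1, 9, 8), (4, 2, 8), (10, 2, 5), (11, 8, 2), (10, 11, 2),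
   (3, 5, 8), (7, 6, 3), (3, 11, 7), (3, 8, 11), (6, 4, 10), (8, 9, 4), (9, 11, 4), (4, 11, 10),
   (5, 7, 10), (10, 9, 6), (7, 9, 10), (7, 11, 9)]

/-- The orientation of `mapN1`. -/
def orientN1 (a b c : Fin 12) : Prop :=
  (a, b, c) ∈ orientedFacesN1 ∨ (b, c, a) ∈ orientedFacesN1 ∨ (c, a, b) ∈ orientedFacesN1

instance (a b c : Fin 12) : Decidable (orientN1 a b c) := by unfold orientN1; infer_instance

lemma orientN1_face : ∀ p ∈ orientedFacesN1, ({p.1, p.2.1, p.2.2} : Finset (Fin 12)) ∈ mapN1 := by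
  decide +kernel

lemma orientN1_exactly_one : ∀ f ∈ mapN1, ∀ a ∈ f, ∀ b ∈ f, ∀ c ∈ f, a ≠ b → a ≠ c → b ≠ c →
    Xor (orientN1 a b c) (orientN1 a c b) := by
  unfold Xor
  exact Finset.filter_eq_self.1 (by decide +kernel)

lemma orientN1_coherent : ∀ a b c c', orientN1 a b c → orientN1 a b c' → c = c' := by
  decide +kernel

lemma card_three_mapN1 : ∀ f ∈ mapN1, f.card = 3 :=
  Finset.filter_eq_self.1 (by decide +kernel)

lemma isOrientation_mapN1 : IsOrientation mapN1 orientN1 := by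
  refine ⟨?_, ?_, ?_, orientN1_coherent⟩
  · rintro a b c (h | h | h)
    · exact orientN1_face _ h
    · have := orientN1_face _ h
      rwa [Finset.pair_comm, Finset.insert_comm] at this
    · have := orientN1_face _ h
      rwa [Finset.insert_comm, Finset.pair_comm] at this
  · rintro a b c (h | h | h)
    · exact Or.inr (Or.inr h)
    · exact Or.inl h
    · exact Or.inr (Or.inl h)
  · intro a b c h
    have h3 := card_three_mapN1 _ h
    refine orientN1_exactly_one _ h a (by simp) b (by simp) c (by simp) ?_ ?_ ?_
    · rintro rfl
      have h2 := Finset.card_le_two (a := a) (b := c)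
      simp at h3; omega
    · rintro rfl
      have h2 := Finset.card_le_two (a := b) (b := a)
      simp at h3; omega
    · rintro rfl
      have h2 := Finset.card_le_two (a := a) (b := b)
      simp at h3; omega

lemma two_faces_mapN1 : ∀ e ∈ edges mapN1, (mapN1.filter fun f => e ⊆ f).card = 2 :=
  Finset.filter_eq_self.1 (by decide +kernel)

lemma isOfType3_mapN1 : IsOfType3 mapN1 7 := by
  unfold IsOfType3
  decide +kernel

lemma connected_mapN1 : (dualGraph mapN1).Connected :=
  connected_of_spread (f0 := {0, 1, 2}) (by decide +kernel) 8 (by decide +kernel)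

/-- Three rounds suffice because the seven faces at a vertex form a 7-cycle. -/
lemma star_spread_mapN1 : ∀ v : Fin 12, ∃ f0 ∈ mapN1.filter (v ∈ ·),
    mapN1.filter (v ∈ ·) ⊆ (spread (mapN1.filter (v ∈ ·)))^[3] {f0} := by
  decide +kernel

lemma isTriangulatedSurface_mapN1 : IsTriangulatedSurface mapN1 :=
  ⟨card_three_mapN1, two_faces_mapN1, fun v => by
    obtain ⟨f0, hf0, h⟩ := star_spread_mapN1 v
    exact star_connected_of_spread hf0 3 h, connected_mapN1⟩

/-! ### Counts and code parameters for type [3^7] -/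

section Counts

variable {V : Type*} [DecidableEq V] [Fintype V] {F : Finset (Finset V)}

/-- The numbers of faces and edges of a surface of type [3^7] with `12 d` vertices. -/
lemma card_faces_edges (hF : IsTriangulatedSurface F) (hq : IsOfType3 F 7) {d : ℕ}
    (hV : Fintype.card V = 12 * d) : F.card = 28 * d ∧ (edges F).card = 42 * d := by
  have h1 := hF.card_mul_eq hq
  have h2 := hF.card_edges
  omega

lemma eulerChar_eq (hF : IsTriangulatedSurface F) (hq : IsOfType3 F 7) {d : ℕ}
    (hV : Fintype.card V = 12 * d) : eulerChar F = -2 * (d : ℤ) := by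
  obtain ⟨h1, h2⟩ := card_faces_edges hF hq hV
  rw [eulerChar, h1, h2, hV]
  push_cast
  ring

/-- The value of `k` comes from `12 d + 28 d + 2 (1 + d) = 42 d + 2`. -/
lemma givesCode_of_type37 (hF : IsTriangulatedSurface F) (hq : IsOfType3 F 7) {d : ℕ}
    (hV : Fintype.card V = 12 * d) :
    (∃ δ, 3 ≤ δ ∧ GivesCode F (42 * d) (2 * (1 + d)) δ) ∧
      (GivesCode F (42 * d) (2 * (1 + d)) 3 ↔
        ∃ t : ZMod 3 → V, IsCycle F t ∧ IsNonseparating F t) := by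
  obtain ⟨h1, h2⟩ := card_faces_edges hF hq hV
  exact givesCode_of_surface hF hq (by norm_num) h2 (by rw [hV, h1]; ring) (by omega)

end Counts

lemma isDoubleTorusMap37_mapN1 : IsDoubleTorusMap37 mapN1 :=
  ⟨isTriangulatedSurface_mapN1, ⟨_, isOrientation_mapN1⟩,
    eulerChar_eq (d := 1) isTriangulatedSurface_mapN1 isOfType3_mapN1 (by simp), isOfType3_mapN1⟩

end SurfaceCode

theorem mainTheorem4 :
    SurfaceCode.IsDoubleTorusMap37 SurfaceCode.mapN1 ∧
    ∀ (V : Type*) [Fintype V] [DecidableEq V] (F : Finset (Finset V)),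
      Fintype.card V = 12 → SurfaceCode.IsDoubleTorusMap37 F →
      SurfaceCode.GivesCode F 42 4 3 ∧
      (∃ c : ZMod 3 → V, SurfaceCode.IsCycle F c ∧ SurfaceCode.IsNonseparating F c) ∧
      ∀ (k : ℕ) (c : ZMod k → V), SurfaceCode.IsCycle F c → SurfaceCode.IsNonseparating F c →
        (∃ B : Finset (V × Finset V), SurfaceCode.IsCutSide F c B) ∧
        ∀ B : Finset (V × Finset V), SurfaceCode.IsCutSide F c B →
        ∀ (d : ℕ) [NeZero d],
          (SurfaceCode.IsTriangulatedSurface (SurfaceCode.coverFaces F B d) ∧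
            SurfaceCode.IsOrientable (SurfaceCode.coverFaces F B d) ∧
            SurfaceCode.IsOfType3 (SurfaceCode.coverFaces F B d) 7 ∧
            Fintype.card (V × ZMod d) = 12 * d ∧
            (SurfaceCode.edges (SurfaceCode.coverFaces F B d)).card = 42 * d ∧
            SurfaceCode.eulerChar (SurfaceCode.coverFaces F B d) = -2 * (d : ℤ)) ∧
          (∃ δ : ℕ, 3 ≤ δ ∧
            SurfaceCode.GivesCode (SurfaceCode.coverFaces F B d) (42 * d) (2 * (1 + d)) δ) ∧
          (SurfaceCode.GivesCode (SurfaceCode.coverFaces F B d) (42 * d) (2 * (1 + d)) 3 ↔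
            ∃ t : ZMod 3 → V × ZMod d, SurfaceCode.IsCycle (SurfaceCode.coverFaces F B d) t ∧
              SurfaceCode.IsNonseparating (SurfaceCode.coverFaces F B d) t) ∧
          (k = 3 →
            SurfaceCode.GivesCode (SurfaceCode.coverFaces F B d) (42 * d) (2 * (1 + d)) 3) := by
  refine ⟨SurfaceCode.isDoubleTorusMap37_mapN1, fun V _ _ F hV hN => ?_⟩
  have hF := hN.surface
  have htri := SurfaceCode.exists_nonseparating_triangle hF hN.type37 hV
  -- The base map is the case `d = 1` of the general count.
  refine ⟨(SurfaceCode.givesCode_of_type37 (d := 1) hF hN.type37 hV).2.2 htri, htri,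
    fun k c hc hns => ?_⟩
  obtain ⟨o, ho⟩ := hN.orientable
  refine ⟨SurfaceCode.exists_isCutSide ho hF hc, fun B hB d _ => ?_⟩
  have hS := SurfaceCode.isTriangulatedSurface_cover (d := d) hF hB hc hns
  have hT := SurfaceCode.isOfType3_cover (B := B) (d := d) hF hN.type37
  have hcard : Fintype.card (V × ZMod d) = 12 * d := by
    rw [Fintype.card_prod, hV, ZMod.card]
  have hcode := SurfaceCode.givesCode_of_type37 hS hT hcard
  refine ⟨⟨hS, SurfaceCode.isOrientable_cover hF ⟨o, ho⟩, hT, hcard,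
    (SurfaceCode.card_faces_edges hS hT hcard).2, SurfaceCode.eulerChar_eq hS hT hcard⟩,
    hcode.1, hcode.2, ?_⟩
  rintro rfl
  exact hcode.2.2 ⟨_, SurfaceCode.isCycle_lift hF hB hc 0,
    SurfaceCode.isNonseparating_lift hF hB hc hns⟩
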